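/- Let $\phi(x)=(x-1-\log x)/2$ for $x\ge 1$ and let $\phi^{-1}:[0,\infty)\to[1,\infty)$ be its inverse. Let $n$ be the sample size, $\mu\in\mathbb{R}^n$, $\sigma>0$, and observe $Y_i=\mu_i+\sigma\varepsilon_i$, $i=1,\dots,n$, with $\varepsilon_1,\dots,\varepsilon_n$ i.i.d. standard Gaussian; $\|\cdot\|$ is the Euclidean norm. Let $\mathcal{S}=\{S_m,\ m\in\mathcal{M}\}$ be a finite or countable collection of linear subspaces of $\mathbb{R}^n$, $D_m=\dim S_m$, $\Pi_m$ the orthogonal projector onto $S_m$, $\mu_m=\Pi_m\mu$, $\hat\mu_m=\Pi_mY$, and $R(\mu,\mathcal{S})=\inf_{m\in\mathcal{M}}\mathbb{E}[\|\mu-\hat\mu_m\|^2]$. Let $K>1$, $M\ge 0$, $a\ge 0$, and put $t=K\phi^{-1}(a)>1$, $\gamma_1=(2t)\vee\frac{t+1}{t-1}$, $\gamma_2=\frac{2\phi(K)}{(t-1)^2}$. Assume that * $\mathcal{S}$ has complexity index $(M,a)$: $|\{m\in\mathcal{M}:D_m=D\}|\le Me^{aD}$ for every integer $D\ge 1$;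 * $D_m\le\lfloor(n-\gamma_1)_+\rfloor\wedge\lfloor((n+2)\gamma_2-1)_+\rfloor$ for every $m\in\mathcal{M}$. Let $\mathrm{pen}:\mathcal{M}\to\mathbb{R}_+$ satisfy $\mathrm{pen}(m)\ge K^2\phi^{-1}(a)D_m$ for all $m\in\mathcal{M}$, and let the random index $\hat m$ almost surely minimize over $\mathcal{M}$ $$\mathrm{Crit}_L(m)=\|Y-\Pi_mY\|^2\Bigl(1+\frac{\mathrm{pen}(m)}{n-D_m}\Bigr).$$ Then $$\mathbb{E}\Bigl[\frac{\|\mu-\hat\mu_{\hat m}\|^2}{\sigma^2}\Bigr]\le\frac{K}{K-1}\inf_{m\in\mathcal{M}}\Bigl[\frac{\|\mu-\mu_m\|^2}{\sigma^2}\Bigl(1+\frac{\mathrm{pen}(m)}{n-D_m}\Bigr)+\mathrm{pen}(m)-D_m\Bigr]+R,$$ where $$R=\frac{K}{K-1}\Bigl[K^2\phi^{-1}(a)+2K+\frac{8KMe^{-a}}{(e^{\phi(K)/2}-1)^2}\Bigr].$$ In particular, there is a constant $C$ depending only on $K$ and $M$ such that, if $\mathrm{pen}(m)=K^2\phi^{-1}(a)D_m$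 for all $m\in\mathcal{M}$, then $$\mathbb{E}[\|\mu-\hat\mu_{\hat m}\|^2]\le C\,\phi^{-1}(a)\,[R(\mu,\mathcal{S})\vee\sigma^2].$$ -/

import Mathlib

open MeasureTheory ProbabilityTheory

namespace GaussianModelSelection

noncomputable section

/-- `φ(x) = (x - 1 - log x) / 2`, used for `x ≥ 1`. -/
def phi (x : ℝ) : ℝ := (x - 1 - Real.log x) / 2

/-- The reciprocal of `φ`, seen as a map from `[1, ∞)` onto `[0, ∞)`; see `phi_bijOn`. -/
def phiInv (a : ℝ) : ℝ := Function.invFunOn phi (Set.Ici 1) a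

/-- `φ` is a bijection from `[1, ∞)` onto `[0, ∞)`, so that `phiInv` is its genuine inverse. -/
theorem phi_bijOn : Set.BijOn phi (Set.Ici 1) (Set.Ici 0) := by
  have hcont : ContinuousOn phi (Set.Ici 1) := by
    unfold phi
    refine ((continuousOn_id.sub continuousOn_const).sub ?_).div_const 2
    exact Real.continuousOn_log.mono fun x hx => by
      have : (1 : ℝ) ≤ x := hx
      simp only [Set.mem_compl_iff, Set.mem_singleton_iff]
      linarith
  have hmono : StrictMonoOn phi (Set.Ici 1) := by
    intro x hx y hy hxy
    have hx1 : (1 : ℝ) ≤ x := hx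
    have hx0 : 0 < x := by linarith
    have hy0 : 0 < y := by linarith
    have hne : y / x ≠ 1 := by
      rw [Ne, div_eq_one_iff_eq hx0.ne']
      exact hxy.ne'
    have h := Real.log_lt_sub_one_of_pos (div_pos hy0 hx0) hne
    rw [Real.log_div hy0.ne' hx0.ne'] at h
    have h2 : y / x - 1 ≤ y - x := by
      have : y / x - 1 = (y - x) / x := by field_simp
      rw [this]
      exact div_le_self (by linarith) hx1
    simp only [phi]
    linarith
  have hone : phi 1 = 0 := by simp [phi]
  refine ⟨?_, hmono.injOn, ?_⟩
  · intro x hx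
    have := hmono.monotoneOn (Set.self_mem_Ici (a := (1 : ℝ))) hx hx
    rw [hone] at this
    exact this
  · intro a ha
    have ha0 : (0 : ℝ) ≤ a := ha
    have hle : (1 : ℝ) ≤ (4 * a + 4) ^ 2 := by nlinarith
    have hbig : a ≤ phi ((4 * a + 4) ^ 2) := by
      have hl : Real.log ((4 * a + 4) ^ 2) ≤ 2 * (4 * a + 3) := by
        rw [Real.log_pow]
        have := Real.log_le_sub_one_of_pos (show (0 : ℝ) < 4 * a + 4 by linarith)
        push_cast
        linarith
      simp only [phi]
      nlinarith
    have hiv := intermediate_value_Icc hle (hcont.mono Set.Icc_subset_Ici_self)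
    obtain ⟨x, hx, hxa⟩ := hiv ⟨by rw [hone]; exact ha0, hbig⟩
    exact ⟨x, hx.1, hxa⟩

/-- `t_{a,K} = K φ⁻¹(a)`. -/
def tParam (K a : ℝ) : ℝ := K * phiInv a

/-- `γ₁ = (2 t) ∨ ((t + 1) / (t - 1))`. -/
def gamma₁ (K a : ℝ) : ℝ :=
  max (2 * tParam K a) ((tParam K a + 1) / (tParam K a - 1))

/-- `γ₂ = 2 φ(K) / (t - 1)²`. -/
def gamma₂ (K a : ℝ) : ℝ := 2 * phi K / (tParam K a - 1) ^ 2

/-- `D_max = ⌊(n - γ₁)₊⌋ ∧ ⌊((n + 2) γ₂ - 1)₊⌋`. -/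
def dimMax (n : ℕ) (K a : ℝ) : ℕ :=
  min ⌊max ((n : ℝ) - gamma₁ K a) 0⌋₊ ⌊max (((n : ℝ) + 2) * gamma₂ K a - 1) 0⌋₊

variable {n : ℕ} {ι : Type*} {Ω : Type*}

/-- The dimension `D_m` of the model `S_m`. -/
def modelDim (S : ι → Submodule ℝ (EuclideanSpace ℝ (Fin n))) (m : ι) : ℕ :=
  Module.finrank ℝ (S m)

/-- The collection `S` has complexity index `(M, a)`. -/
def HasComplexityIndex (S : ι → Submodule ℝ (EuclideanSpace ℝ (Fin n))) (M a : ℝ) : Prop :=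
  ∀ D : ℕ, 1 ≤ D →
    {m | modelDim S m = D}.Finite ∧
      ({m | modelDim S m = D}.ncard : ℝ) ≤ M * Real.exp (a * D)

/-- Assumption `(H_{K,M,a})`. -/
def AssumptionH (S : ι → Submodule ℝ (EuclideanSpace ℝ (Fin n))) (K M a : ℝ) : Prop :=
  HasComplexityIndex S M a ∧ ∀ m, modelDim S m ≤ dimMax n K a

/-- The observation `Y_i = μ_i + σ ε_i`. -/
def obs (μ : EuclideanSpace ℝ (Fin n)) (σ : ℝ) (ε : Fin n → Ω → ℝ) (ω : Ω) :
    EuclideanSpace ℝ (Fin n) :=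
  WithLp.toLp 2 fun i => μ i + σ * ε i ω

/-- The orthogonal projection `Π_m y` onto `S_m`; `Π_m Y` is the least-squares estimator. -/
def proj (S : ι → Submodule ℝ (EuclideanSpace ℝ (Fin n))) (m : ι)
    (y : EuclideanSpace ℝ (Fin n)) : EuclideanSpace ℝ (Fin n) :=
  (S m).starProjection y

/-- The criterion `Crit_L(m) = ‖y - Π_m y‖² (1 + pen(m) / (n - D_m))` at the observation `y`. -/
def critL (S : ι → Submodule ℝ (EuclideanSpace ℝ (Fin n))) (pen : ι → ℝ)
    (y : EuclideanSpace ℝ (Fin n)) (m : ι) : ℝ :=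
  ‖y - proj S m y‖ ^ 2 * (1 + pen m / ((n : ℝ) - modelDim S m))

/-- The minimal risk `R(μ, S) = inf_m E ‖μ - Π_m Y‖²`. -/
def oracleRisk [MeasurableSpace Ω] (P : Measure Ω) (Y : Ω → EuclideanSpace ℝ (Fin n))
    (μ : EuclideanSpace ℝ (Fin n)) (S : ι → Submodule ℝ (EuclideanSpace ℝ (Fin n))) : ℝ :=
  ⨅ m, ∫ ω, ‖μ - proj S m (Y ω)‖ ^ 2 ∂P

/-- The remainder term of the risk bound. -/
def remainder (K M a : ℝ) : ℝ :=
  K / (K - 1) *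
    (K ^ 2 * phiInv a + 2 * K + 8 * K * M * Real.exp (-a) / (Real.exp (phi K / 2) - 1) ^ 2)

end

end GaussianModelSelection

open GaussianModelSelection

/-! Write `D` for the dimension of the selected model `S`, enlarge `S` to a space `W` of dimension
`D + 1` containing `μ`, and let `U`, `V` be the squared norms of the projections of the noise onto
`W` and `Wᗮ`. Completing a square (`estimator_loss_le`) bounds `(1 - 1/K)` times the loss by the
residual sum of squares, minus `σ²‖e‖²`, plus `Kσ²U`. The residual is at least `σ²V`
(`le_norm_sq_residual`), so its penalty factor pays for `U`. After comparing criteria with a fixed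
model, what is left is `σ²(K U - V pen / (n - D))`, where `pen ≥ K t D`.

Since `V` is random, `sub_penalty_le_excess` replaces this by `K t` plus `K` times two excesses: `U`
above a multiple of `V`, and `U` above `t (D + 1)`. As `U` and `V` are independent chi-squares, each
excess has a Chernoff bound of order `exp (-(D + 1) (a + φ(K)/2))`. Two facts give this exponent:
`φ(Kφ⁻¹(a)) ≥ φ(K) + a` (`add_le_phi_tParam`), and the dimension restriction, through which the
fluctuation of `V` costs at most half of `φ(K)` (`exp_chernoff_le`). The part `a` cancels the number
of models of each dimension, the part `φ(K)/2` makes the sum over dimensions geometric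
(`sum_models_le`), and the expected criterion of the fixed model supplies the main term. -/

namespace GaussianModelSelection

/-! ### The function `φ` and the Chernoff exponent -/

theorem one_le_phiInv {a : ℝ} (ha : 0 ≤ a) : 1 ≤ phiInv a :=
  Function.invFunOn_mem (phi_bijOn.surjOn ha)

theorem phi_phiInv {a : ℝ} (ha : 0 ≤ a) : phi (phiInv a) = a :=
  Function.invFunOn_eq (phi_bijOn.surjOn ha)

theorem phi_nonneg {x : ℝ} (hx : 1 ≤ x) : 0 ≤ phi x := phi_bijOn.mapsTo hx

theorem phi_pos {x : ℝ} (hx : 1 < x) : 0 < phi x := by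
  have h := Real.log_lt_sub_one_of_pos (by linarith) hx.ne'
  simp only [phi]
  linarith

/-- `φ` is superadditive along products. -/
theorem phi_add_le_phi_mul {x y : ℝ} (hx : 1 ≤ x) (hy : 1 ≤ y) :
    phi x + phi y ≤ phi (x * y) := by
  simp only [phi, Real.log_mul (by linarith : x ≠ 0) (by linarith : y ≠ 0)]
  nlinarith [mul_nonneg (sub_nonneg.2 hx) (sub_nonneg.2 hy)]

theorem sub_sq_div_two_le_log {y : ℝ} (hy : 0 ≤ y) : y - y ^ 2 / 2 ≤ Real.log (1 + y) := by
  refine le_trans ?_ (Real.le_log_one_add_of_nonneg hy)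
  rw [le_div_iff₀ (by linarith)]
  nlinarith [pow_nonneg hy 3]

theorem phi_le_sq {x : ℝ} (hx : 1 ≤ x) : phi x ≤ (x - 1) ^ 2 / 4 := by
  have h := sub_sq_div_two_le_log (sub_nonneg.2 hx)
  rw [add_sub_cancel] at h
  simp only [phi]
  linarith

theorem phi_le_half {x : ℝ} (hx : 1 ≤ x) : phi x ≤ (x - 1) / 2 := by
  have := Real.log_nonneg hx
  simp only [phi]
  linarith

/-- `x ↦ x log (1 + 1/x)` is monotone. -/
theorem mul_log_one_add_inv_le {x y : ℝ} (hx : 0 < x) (hxy : x ≤ y) :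
    x * Real.log ((x + 1) / x) ≤ y * Real.log ((y + 1) / y) := by
  have hy : 0 < y := hx.trans_le hxy
  have h := one_add_mul_self_le_rpow_one_add (s := 1 / y) (p := y / x)
    (by have := one_div_pos.2 hy; linarith) ((one_le_div hx).2 hxy)
  have e1 : 1 + y / x * (1 / y) = (x + 1) / x := by field_simp
  have e2 : 1 + 1 / y = (y + 1) / y := by field_simp
  rw [e1, e2] at h
  have h2 := Real.log_le_log (by positivity) h
  rw [Real.log_rpow (by positivity)] at h2
  calc x * Real.log ((x + 1) / x) ≤ x * (y / x * Real.log ((y + 1) / y)) := by gcongr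
    _ = _ := by field_simp

/-- The exponential moment of `U - (t d / (N + 1)) V`, for independent `U ∼ χ²(d)` and
`V ∼ χ²(N)`, at a nearly optimal parameter. -/
theorem chernoff_exponent_le {d N t x : ℝ} (hd : 0 < d) (hN : 0 < N) (ht : 1 < t)
    (hx : x = ((t - 1) * N - 1) / (t * (d + N))) :
    -(d / 2) * Real.log (1 - x) - N / 2 * Real.log (1 + t * d / (N + 1) * x) ≤
      Real.log (1 + d * (t - 1) / (d + N + 2)) - d * phi t
        + (d * (t - 1)) ^ 2 / (4 * (d + N + 2)) := by
  have hs : 0 < t - 1 := by linarith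
  have ht0 : 0 < t := by linarith
  set n := d + N with hn
  have hn0 : 0 < n := by positivity
  set z := d * (t - 1) with hz
  have hz0 : 0 < z := by positivity
  -- The derivative of the left side vanishes at this `x`. Both arguments become multiples of `(n +
  -- 1 + z) / n`, so the exponent collapses to `-(n/2) log ((n + 1 + z) / n)` plus terms free of
  -- `z`.
  have e1 : 1 - x = (n + 1 + z) / n / t := by
    rw [hx, hz, hn]; field_simp; ring
  have e2 : 1 + t * d / (N + 1) * x = (n + 1 + z) / n / ((N + 1) / N) := by
    rw [hx, hz, hn]; field_simp; ring
  have e3 : (n + 1 + z) / n = (1 + z / (n + 1)) * ((n + 1) / n) := by field_simp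
  have h1 : Real.log ((n + 1 + z) / n) = Real.log (1 + z / (n + 1)) + Real.log ((n + 1) / n) := by
    rw [e3, Real.log_mul (by positivity) (by positivity)]
  have hmono := mul_log_one_add_inv_le hN (by linarith : N ≤ n)
  -- The denominator `n + 2` is the one in `γ₂`. Writing `n B = (n + 2) B - 2 B` with `B = log (1 +
  -- z / (n + 2))`, the leftover `2 B`, halved, is the logarithm in the conclusion.
  have hlog : Real.log (1 + z / (n + 2)) ≤ Real.log (1 + z / (n + 1)) := by
    apply Real.log_le_log (by positivity)
    gcongr
    linarith
  have hq := sub_sq_div_two_le_log (y := z / (n + 2)) (by positivity)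
  have hq2 : (n + 2) * (z / (n + 2) - (z / (n + 2)) ^ 2 / 2) ≤
      (n + 2) * Real.log (1 + z / (n + 2)) := by gcongr
  have e4 : (n + 2) * (z / (n + 2) - (z / (n + 2)) ^ 2 / 2) = z - 2 * (z ^ 2 / (4 * (n + 2))) := by
    field_simp; ring
  rw [e4] at hq2
  have hnlog : n * Real.log (1 + z / (n + 2)) ≤ n * Real.log (1 + z / (n + 1)) := by gcongr
  have h2 : Real.log ((n + 1 + z) / n / t) = Real.log ((n + 1 + z) / n) - Real.log t :=
    Real.log_div (by positivity) ht0.ne'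
  have h3 : Real.log ((n + 1 + z) / n / ((N + 1) / N)) =
      Real.log ((n + 1 + z) / n) - Real.log ((N + 1) / N) :=
    Real.log_div (by positivity) (by positivity)
  rw [e1, e2, h2, h3, h1]
  simp only [phi]
  generalize Real.log (1 + z / (n + 1)) = A at *
  generalize Real.log (1 + z / (n + 2)) = B at *
  generalize Real.log ((n + 1) / n) = C at *
  have hN' : N * (A + C) = n * (A + C) - d * (A + C) := by rw [hn]; ring
  have hzz : d * t = z + d := by rw [hz]; ring
  linarith

/-! ### Exponential moments of a squared Gaussian -/

section Real

variable {y : ℝ}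

/-- A quadratic exponential tilt only changes the variance, so the moments below reduce to the mass
and variance of a centred Gaussian. -/
theorem gaussianPDFReal_mul_exp_sq (hy : y < 1) (x : ℝ) :
    gaussianPDFReal 0 1 x * Real.exp (y / 2 * x ^ 2) =
      (√(1 - y))⁻¹ * gaussianPDFReal 0 ((1 - y)⁻¹).toNNReal x := by
  have h1 : 0 < 1 - y := sub_pos.2 hy
  simp only [gaussianPDFReal, NNReal.coe_one, sub_zero, mul_one,
    Real.coe_toNNReal _ (inv_nonneg.2 h1.le)]
  rw [mul_assoc, ← Real.exp_add, Real.sqrt_mul (by positivity : 0 ≤ 2 * Real.pi) (1 - y)⁻¹, Real.sqrt_inv, mul_inv, inv_inv]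
  have : -x ^ 2 / 2 + y / 2 * x ^ 2 = -x ^ 2 / (2 * (1 - y)⁻¹) := by field_simp; ring
  rw [this]
  have : √(1 - y) ≠ 0 := (Real.sqrt_pos.2 h1).ne'
  field_simp

theorem integral_mul_exp_sq_gaussianReal (hy : y < 1) (f : ℝ → ℝ) :
    ∫ x, f x * Real.exp (y / 2 * x ^ 2) ∂(gaussianReal 0 1) =
      (√(1 - y))⁻¹ *
        ∫ x, f x ∂(gaussianReal 0 ((1 - y)⁻¹).toNNReal) := by
  have hv : ((1 - y)⁻¹).toNNReal ≠ 0 := by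
    simpa using hy
  rw [integral_gaussianReal_eq_integral_smul one_ne_zero,
    integral_gaussianReal_eq_integral_smul hv, ← integral_const_mul]
  congr 1 with x
  simp only [smul_eq_mul]
  rw [mul_left_comm, gaussianPDFReal_mul_exp_sq hy]
  ring

theorem integral_exp_sq_gaussianReal (hy : y < 1) :
    ∫ x, Real.exp (y / 2 * x ^ 2) ∂(gaussianReal 0 1) = (√(1 - y))⁻¹ := by
  simpa using integral_mul_exp_sq_gaussianReal hy (fun _ => 1)

theorem integral_sq_mul_exp_sq_gaussianReal (hy : y < 1) :
    ∫ x, x ^ 2 * Real.exp (y / 2 * x ^ 2) ∂(gaussianReal 0 1) = (1 - y)⁻¹ * (√(1 - y))⁻¹ := by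
  rw [integral_mul_exp_sq_gaussianReal hy, mul_comm]
  congr 1
  have := variance_fun_id_gaussianReal (μ := 0)
    (v := ((1 - y)⁻¹).toNNReal)
  rw [variance_eq_integral (by fun_prop)] at this
  simpa [hy.le] using this

theorem integrable_exp_sq_gaussianReal (hy : y < 1) :
    Integrable (fun x => Real.exp (y / 2 * x ^ 2)) (gaussianReal 0 1) := by
  -- The Bochner integral of a non-integrable function is 0, so a nonzero value proves
  -- integrability.
  refine Integrable.of_integral_ne_zero ?_
  rw [integral_exp_sq_gaussianReal hy]
  exact (inv_pos.2 (Real.sqrt_pos.2 (sub_pos.2 hy))).ne'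

theorem integrable_sq_mul_exp_sq_gaussianReal (hy : y < 1) :
    Integrable (fun x => x ^ 2 * Real.exp (y / 2 * x ^ 2)) (gaussianReal 0 1) := by
  refine Integrable.of_integral_ne_zero ?_
  rw [integral_sq_mul_exp_sq_gaussianReal hy]
  have := sub_pos.2 hy
  positivity

end Real

/-! ### Products of Gaussian moments -/

section Pi

variable {κ : Type*} [Fintype κ] {y : κ → ℝ}

theorem hasIntegral_exp_sum_sq_pi (hy : ∀ i, y i < 1) :
    Integrable (fun x : κ → ℝ => Real.exp (∑ i, y i / 2 * x i ^ 2))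
        (Measure.pi fun _ => gaussianReal 0 1) ∧
      ∫ x : κ → ℝ, Real.exp (∑ i, y i / 2 * x i ^ 2) ∂(Measure.pi fun _ => gaussianReal 0 1) =
        ∏ i, (√(1 - y i))⁻¹ := by
  simp only [Real.exp_sum]
  refine ⟨Integrable.fintype_prod (f := fun i (u : ℝ) => Real.exp (y i / 2 * u ^ 2))
    fun i => integrable_exp_sq_gaussianReal (hy i), ?_⟩
  rw [integral_fintype_prod_eq_prod (f := fun i (u : ℝ) => Real.exp (y i / 2 * u ^ 2))]
  simp only [integral_exp_sq_gaussianReal (hy _)]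

theorem hasIntegral_sq_mul_exp_sum_sq_pi (hy : ∀ i, y i < 1) (j : κ) :
    Integrable (fun x : κ → ℝ => x j ^ 2 * Real.exp (∑ i, y i / 2 * x i ^ 2))
        (Measure.pi fun _ => gaussianReal 0 1) ∧
      ∫ x : κ → ℝ, x j ^ 2 * Real.exp (∑ i, y i / 2 * x i ^ 2)
          ∂(Measure.pi fun _ => gaussianReal 0 1) =
        (1 - y j)⁻¹ * ∏ i, (√(1 - y i))⁻¹ := by
  classical
  let f : κ → ℝ → ℝ := fun i u => (if i = j then u ^ 2 else 1) * Real.exp (y i / 2 * u ^ 2)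
  have hf : ∀ i, Integrable (f i) (gaussianReal 0 1) := fun i => by
    by_cases h : i = j
    · simpa only [f, h, if_true] using integrable_sq_mul_exp_sq_gaussianReal (hy j)
    · simpa only [f, h, if_false, one_mul] using integrable_exp_sq_gaussianReal (hy i)
  have hi : ∀ i, ∫ u, f i u ∂(gaussianReal 0 1) =
      (if i = j then (1 - y i)⁻¹ else 1) * (√(1 - y i))⁻¹ := fun i => by
    by_cases h : i = j
    · simpa only [f, h, if_true] using integral_sq_mul_exp_sq_gaussianReal (hy j)
    · simpa only [f, h, if_false, one_mul] using integral_exp_sq_gaussianReal (hy i)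
  have hprod : ∀ x : κ → ℝ, x j ^ 2 * Real.exp (∑ i, y i / 2 * x i ^ 2) = ∏ i, f i (x i) := by
    intro x
    simp only [f, Finset.prod_mul_distrib, Real.exp_sum]
    simp
  simp only [hprod]
  refine ⟨Integrable.fintype_prod hf, ?_⟩
  rw [integral_fintype_prod_eq_prod (f := f)]
  simp only [hi, Finset.prod_mul_distrib]
  simp

end Pi

/-! ### Projections of a standard Gaussian vector -/

section Subspace

open Module

variable {E : Type*} [NormedAddCommGroup E] [InnerProductSpace ℝ E] [FiniteDimensional ℝ E]

/-- An orthonormal basis of the space adapted to the decomposition `W ⊕ Wᗮ`. -/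
noncomputable def adaptedBasis (W : Submodule ℝ E) :
    OrthonormalBasis (Fin (finrank ℝ W) ⊕ Fin (finrank ℝ Wᗮ)) ℝ E :=
  ((stdOrthonormalBasis ℝ W).prod (stdOrthonormalBasis ℝ Wᗮ)).map W.orthogonalDecomposition.symm

theorem adaptedBasis_inl (W : Submodule ℝ E) (i : Fin (finrank ℝ W)) :
    adaptedBasis W (Sum.inl i) = stdOrthonormalBasis ℝ W i := by
  simp [adaptedBasis]

theorem adaptedBasis_inr (W : Submodule ℝ E) (i : Fin (finrank ℝ Wᗮ)) :
    adaptedBasis W (Sum.inr i) = stdOrthonormalBasis ℝ Wᗮ i := by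
  simp [adaptedBasis]

theorem norm_sq_sum_smul (W : Submodule ℝ E) (x : Fin (finrank ℝ W) → ℝ) :
    ‖∑ i, x i • ((stdOrthonormalBasis ℝ W i : W) : E)‖ ^ 2 = ∑ i, x i ^ 2 := by
  have h := (stdOrthonormalBasis ℝ W).sum_sq_norm_inner_right (∑ i, x i • stdOrthonormalBasis ℝ W i)
  have e : ∑ i, x i • ((stdOrthonormalBasis ℝ W i : W) : E) =
    ((∑ i, x i • stdOrthonormalBasis ℝ W i : W) : E) := by simp
  rw [e, Submodule.norm_coe, ← h]
  refine Finset.sum_congr rfl fun i _ => ?_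
  rw [(stdOrthonormalBasis ℝ W).orthonormal.inner_right_fintype, Real.norm_eq_abs, sq_abs]

theorem starProjection_sum_adaptedBasis (W : Submodule ℝ E)
    (x : Fin (finrank ℝ W) ⊕ Fin (finrank ℝ Wᗮ) → ℝ) :
    W.starProjection (∑ i, x i • adaptedBasis W i) =
      ∑ i, x (Sum.inl i) • ((stdOrthonormalBasis ℝ W i : W) : E) := by
  rw [Fintype.sum_sum_type, map_add, map_sum, map_sum]
  simp only [adaptedBasis_inl, adaptedBasis_inr, map_smul]
  have h1 : ∀ i, W.starProjection (stdOrthonormalBasis ℝ W i : E) = stdOrthonormalBasis ℝ W i :=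
    fun i => Submodule.starProjection_eq_self_iff.2 (Subtype.coe_prop _)
  have h2 : ∀ i, W.starProjection (stdOrthonormalBasis ℝ Wᗮ i : E) = 0 :=
    fun i => (Submodule.starProjection_apply_eq_zero_iff W).2 (Subtype.coe_prop _)
  simp [h1, h2]

theorem norm_sq_starProjection_sum_adaptedBasis (W : Submodule ℝ E)
    (x : Fin (finrank ℝ W) ⊕ Fin (finrank ℝ Wᗮ) → ℝ) :
    ‖W.starProjection (∑ i, x i • adaptedBasis W i)‖ ^ 2 = ∑ i, x (Sum.inl i) ^ 2 := by
  rw [starProjection_sum_adaptedBasis, norm_sq_sum_smul W fun i => x (Sum.inl i)]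

theorem norm_sq_sub_starProjection_sum_adaptedBasis (W : Submodule ℝ E)
    (x : Fin (finrank ℝ W) ⊕ Fin (finrank ℝ Wᗮ) → ℝ) :
    ‖(∑ i, x i • adaptedBasis W i) - W.starProjection (∑ i, x i • adaptedBasis W i)‖ ^ 2 =
      ∑ i, x (Sum.inr i) ^ 2 := by
  rw [starProjection_sum_adaptedBasis, Fintype.sum_sum_type]
  simp only [adaptedBasis_inl, adaptedBasis_inr, add_sub_cancel_left]
  exact norm_sq_sum_smul Wᗮ fun i => x (Sum.inr i)

theorem inv_sqrt_pow_eq_exp {u : ℝ} (hu : 0 < u) (k : ℕ) :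
    (√u)⁻¹ ^ k = Real.exp (-(k / 2) * Real.log u) := by
  rw [inv_pow, ← Real.exp_log (pow_pos (Real.sqrt_pos.2 hu) k), ← Real.exp_neg, Real.log_pow,
    Real.log_sqrt hu.le]
  congr 1; ring

variable [MeasurableSpace E] [BorelSpace E] {y w : ℝ}

/-- The joint exponential moments of the squared norms of the projections of a standard Gaussian
vector onto `W` and `Wᗮ`. -/
theorem hasIntegral_exp_stdGaussian (W : Submodule ℝ E) (hy : y < 1) (hw : w < 1) :
    Integrable (fun e => Real.exp (y / 2 * ‖W.starProjection e‖ ^ 2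
        + w / 2 * ‖e - W.starProjection e‖ ^ 2)) (stdGaussian E) ∧
      ∫ e, Real.exp (y / 2 * ‖W.starProjection e‖ ^ 2
        + w / 2 * ‖e - W.starProjection e‖ ^ 2) ∂(stdGaussian E) =
        Real.exp (-(finrank ℝ W / 2) * Real.log (1 - y)
          - finrank ℝ Wᗮ / 2 * Real.log (1 - w)) := by
  have hg := hasIntegral_exp_sum_sq_pi
    (y := Sum.elim (fun _ : Fin (finrank ℝ W) => y) (fun _ : Fin (finrank ℝ Wᗮ) => w))
    (by rintro (i | i) <;> simpa)
  rw [stdGaussian_eq_map_pi_orthonormalBasis (adaptedBasis W),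
    integrable_map_measure (by fun_prop) (Measurable.aemeasurable (by fun_prop)),
    integral_map (Measurable.aemeasurable (by fun_prop)) (by fun_prop)]
  simp only [Function.comp_def, norm_sq_starProjection_sum_adaptedBasis,
    norm_sq_sub_starProjection_sum_adaptedBasis]
  simp only [Fintype.sum_sum_type, Sum.elim_inl, Sum.elim_inr, ← Finset.mul_sum,
    Fintype.prod_sum_type, Finset.prod_const, Finset.card_univ, Fintype.card_fin] at hg
  rw [inv_sqrt_pow_eq_exp (sub_pos.2 hy), inv_sqrt_pow_eq_exp (sub_pos.2 hw), ← Real.exp_add] at hg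
  refine ⟨hg.1, hg.2.trans ?_⟩
  congr 1; ring

theorem hasIntegral_norm_sq_mul_exp_stdGaussian (W : Submodule ℝ E) (hy : y < 1) (hw : w < 1) :
    Integrable (fun e => ‖W.starProjection e‖ ^ 2 * Real.exp (y / 2 * ‖W.starProjection e‖ ^ 2
        + w / 2 * ‖e - W.starProjection e‖ ^ 2)) (stdGaussian E) ∧
      ∫ e, ‖W.starProjection e‖ ^ 2 * Real.exp (y / 2 * ‖W.starProjection e‖ ^ 2
        + w / 2 * ‖e - W.starProjection e‖ ^ 2) ∂(stdGaussian E) =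
        finrank ℝ W * ((1 - y)⁻¹ * Real.exp (-(finrank ℝ W / 2) * Real.log (1 - y)
          - finrank ℝ Wᗮ / 2 * Real.log (1 - w))) := by
  have hg := fun j : Fin (finrank ℝ W) => hasIntegral_sq_mul_exp_sum_sq_pi
    (y := Sum.elim (fun _ : Fin (finrank ℝ W) => y) (fun _ : Fin (finrank ℝ Wᗮ) => w))
    (by rintro (i | i) <;> simpa) (Sum.inl j)
  rw [stdGaussian_eq_map_pi_orthonormalBasis (adaptedBasis W),
    integrable_map_measure (by fun_prop) (Measurable.aemeasurable (by fun_prop)),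
    integral_map (Measurable.aemeasurable (by fun_prop)) (by fun_prop)]
  simp only [Function.comp_def, norm_sq_starProjection_sum_adaptedBasis,
    norm_sq_sub_starProjection_sum_adaptedBasis]
  simp only [Fintype.sum_sum_type, Sum.elim_inl, Sum.elim_inr, ← Finset.mul_sum,
    Fintype.prod_sum_type, Finset.prod_const, Finset.card_univ, Fintype.card_fin] at hg
  simp only [inv_sqrt_pow_eq_exp (sub_pos.2 hy), inv_sqrt_pow_eq_exp (sub_pos.2 hw),
    ← Real.exp_add] at hg
  simp only [Finset.sum_mul]
  refine ⟨integrable_finsetSum _ fun j _ => (hg j).1, ?_⟩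
  rw [integral_finsetSum _ fun j _ => (hg j).1]
  simp only [(hg _).2, Finset.sum_const, Finset.card_univ, Fintype.card_fin, nsmul_eq_mul]
  congr 3; ring

theorem hasIntegral_norm_sq_stdGaussian (W : Submodule ℝ E) :
    Integrable (fun e => ‖W.starProjection e‖ ^ 2) (stdGaussian E) ∧
      ∫ e, ‖W.starProjection e‖ ^ 2 ∂(stdGaussian E) = finrank ℝ W := by
  simpa using hasIntegral_norm_sq_mul_exp_stdGaussian W (y := 0) (w := 0) one_pos one_pos

end Subspace

/-! ### Chernoff bounds for the excesses -/

section Excess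

open Module

variable {E : Type*} [NormedAddCommGroup E] [InnerProductSpace ℝ E] [FiniteDimensional ℝ E]

/-- The positive part of `U - c V - b`, where `U` and `V` are the squared norms of the projections
of `e` onto `W` and `Wᗮ`. -/
noncomputable def excess (W : Submodule ℝ E) (c b : ℝ) (e : E) : ℝ :=
  max (‖W.starProjection e‖ ^ 2 - c * ‖e - W.starProjection e‖ ^ 2 - b) 0

theorem excess_nonneg (W : Submodule ℝ E) (c b : ℝ) (e : E) : 0 ≤ excess W c b e :=
  le_max_right _ _

theorem excess_le_norm_sq (W : Submodule ℝ E) {c b : ℝ} (hc : 0 ≤ c) (hb : 0 ≤ b) (e : E) :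
    excess W c b e ≤ ‖W.starProjection e‖ ^ 2 := by
  refine max_le ?_ (by positivity)
  have : 0 ≤ c * ‖e - W.starProjection e‖ ^ 2 := by positivity
  linarith

variable [MeasurableSpace E] [BorelSpace E]

theorem measurable_excess (W : Submodule ℝ E) (c b : ℝ) : Measurable (excess W c b) := by
  unfold excess
  fun_prop

theorem integrable_excess (W : Submodule ℝ E) {c b : ℝ} (hc : 0 ≤ c) (hb : 0 ≤ b) :
    Integrable (excess W c b) (stdGaussian E) := by
  refine (hasIntegral_norm_sq_stdGaussian W).1.mono' (measurable_excess W c b).aestronglyMeasurable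
    (Filter.Eventually.of_forall fun e => ?_)
  rw [Real.norm_of_nonneg (excess_nonneg W c b e)]
  exact excess_le_norm_sq W hc hb e

/-- Where the excess is positive it is at most `U`, and `exp (x/2 * (U - cV - b)) ≥ 1`. The
resulting factor `finrank W / (1 - x)` is acceptable for small `t`. -/
theorem integral_excess_le_finrank_mul (W : Submodule ℝ E) {c b x : ℝ} (hc : 0 ≤ c) (hb : 0 ≤ b)
    (hx : 0 ≤ x) (hx1 : x < 1) :
    ∫ e, excess W c b e ∂(stdGaussian E) ≤
      Real.exp (-(x / 2 * b)) * (finrank ℝ W * ((1 - x)⁻¹ *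
        Real.exp (-(finrank ℝ W / 2) * Real.log (1 - x)
          - finrank ℝ Wᗮ / 2 * Real.log (1 + c * x)))) := by
  have hw : -(c * x) < 1 := by nlinarith
  have h := hasIntegral_norm_sq_mul_exp_stdGaussian W hx1 hw
  rw [sub_neg_eq_add] at h
  rw [← h.2, ← integral_const_mul]
  refine integral_mono (integrable_excess W hc hb) (h.1.const_mul _) fun e => ?_
  simp only
  rw [mul_left_comm, ← Real.exp_add]
  have hU := excess_le_norm_sq W hc hb e
  unfold excess at hU ⊢
  set U := ‖W.starProjection e‖ ^ 2
  set V := ‖e - W.starProjection e‖ ^ 2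
  have hU0 : 0 ≤ U := by positivity
  have hr : -(x / 2 * b) + (x / 2 * U + -(c * x) / 2 * V) = x / 2 * (U - c * V - b) := by ring
  rw [hr]
  rcases le_total (U - c * V - b) 0 with h0 | h0
  · rw [max_eq_right h0]; positivity
  · have : 1 ≤ Real.exp (x / 2 * (U - c * V - b)) := Real.one_le_exp (by positivity)
    nlinarith

/-- Here `u ≤ 2 / (x e) * exp (x u / 2)` is used instead: the factor no longer involves the
dimension, which is needed for large `t`. -/
theorem integral_excess_le_two_div (W : Submodule ℝ E) {c b x : ℝ} (hc : 0 ≤ c) (hb : 0 ≤ b)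
    (hx : 0 < x) (hx1 : x < 1) :
    ∫ e, excess W c b e ∂(stdGaussian E) ≤
      Real.exp (-(x / 2 * b)) * (2 / (x * Real.exp 1) *
        Real.exp (-(finrank ℝ W / 2) * Real.log (1 - x)
          - finrank ℝ Wᗮ / 2 * Real.log (1 + c * x))) := by
  have hw : -(c * x) < 1 := by nlinarith
  have h := hasIntegral_exp_stdGaussian W hx1 hw
  rw [sub_neg_eq_add] at h
  rw [← h.2, ← integral_const_mul, ← integral_const_mul]
  refine integral_mono (integrable_excess W hc hb) ((h.1.const_mul _).const_mul _) fun e => ?_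
  simp only
  rw [mul_left_comm, ← Real.exp_add]
  unfold excess
  set U := ‖W.starProjection e‖ ^ 2
  set V := ‖e - W.starProjection e‖ ^ 2
  have hr : -(x / 2 * b) + (x / 2 * U + -(c * x) / 2 * V) = x / 2 * (U - c * V - b) := by ring
  rw [hr]
  refine max_le ?_ (by positivity)
  have h1 := Real.add_one_le_exp (x / 2 * (U - c * V - b) - 1)
  rw [Real.exp_sub, sub_add_cancel] at h1
  rw [div_mul_eq_mul_div, le_div_iff₀ (by positivity)]
  rw [le_div_iff₀ (Real.exp_pos 1)] at h1
  nlinarith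

variable {K a : ℝ}

/-- Superadditivity of `φ` along the product `K * φ⁻¹(a)`. The term `a` will offset the model count
and `φ(K)` will give summability. -/
theorem add_le_phi_tParam (hK : 1 < K) (ha : 0 ≤ a) : phi K + a ≤ phi (tParam K a) := by
  have := phi_add_le_phi_mul hK.le (one_le_phiInv ha)
  rwa [phi_phiInv ha] at this

theorem le_tParam (hK : 1 < K) (ha : 0 ≤ a) : K ≤ tParam K a := by
  have := one_le_phiInv ha
  unfold tParam
  nlinarith

theorem one_lt_tParam (hK : 1 < K) (ha : 0 ≤ a) : 1 < tParam K a :=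
  hK.trans_le (le_tParam hK ha)

/-- The bound on the exponential moments under the restriction on the dimensions. -/
theorem exp_chernoff_le {d N x : ℝ} (hK : 1 < K) (ha : 0 ≤ a) (hd : 0 < d) (hN : 0 < N)
    (hdim : d * (tParam K a - 1) ^ 2 ≤ 2 * (d + N + 2) * phi K)
    (hx : x = ((tParam K a - 1) * N - 1) / (tParam K a * (d + N))) :
    Real.exp (-(d / 2) * Real.log (1 - x)
        - N / 2 * Real.log (1 + tParam K a * d / (N + 1) * x)) ≤
      (1 + d * (tParam K a - 1) / (d + N + 2)) * Real.exp (-(d * (a + phi K / 2))) := by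
  have ht := one_lt_tParam hK ha
  have h := chernoff_exponent_le hd hN ht hx
  have hphi := add_le_phi_tParam hK ha
  set t := tParam K a
  have hs : 0 < t - 1 := by linarith
  have hpos : 0 < 1 + d * (t - 1) / (d + N + 2) := by positivity
  -- The role of `γ₂`: the quadratic term of the exponent uses up at most half of `d * φ(K)`.
  have hq : (d * (t - 1)) ^ 2 / (4 * (d + N + 2)) ≤ d * (phi K / 2) := by
    rw [div_le_iff₀ (by positivity)]
    nlinarith
  rw [← Real.exp_log hpos, ← Real.exp_add]
  refine Real.exp_le_exp.2 (h.trans ?_)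
  nlinarith

/-- The restriction on the dimensions bounds the drift. -/
theorem drift_le_one {d q : ℝ} (hK : 1 < K) (ha : 0 ≤ a) (hq : 0 < q)
    (hdim : d * (tParam K a - 1) ^ 2 ≤ 2 * q * phi K) :
    d * (tParam K a - 1) / q ≤ 1 := by
  have ht := le_tParam hK ha
  have h1 := phi_le_half hK.le
  rw [div_le_one hq]
  have hs : 0 < tParam K a - 1 := by linarith
  refine le_of_mul_le_mul_right ?_ hs
  nlinarith

/-- Follows from `φ(K) ≤ (K - 1)² / 4 ≤ (t - 1)² / 4`. -/
theorem two_mul_dim_le {d q : ℝ} (hK : 1 < K) (ha : 0 ≤ a) (hq : 0 < q)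
    (hdim : d * (tParam K a - 1) ^ 2 ≤ 2 * q * phi K) : 2 * d ≤ q := by
  have ht := le_tParam hK ha
  have h1 := phi_le_sq hK.le
  have hs : 0 < tParam K a - 1 := by linarith
  refine le_of_mul_le_mul_right ?_ (pow_pos hs 2)
  have : (K - 1) ^ 2 ≤ (tParam K a - 1) ^ 2 := by gcongr
  nlinarith

variable (W : Submodule ℝ E)

theorem integral_excess_ratio_le (hK : 1 < K) (ha : 0 ≤ a) (hd : 0 < finrank ℝ W)
    (hN : 0 < finrank ℝ Wᗮ) (hsN : 2 ≤ (tParam K a - 1) * finrank ℝ Wᗮ)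
    (hdim : finrank ℝ W * (tParam K a - 1) ^ 2 ≤
      2 * ((finrank ℝ W : ℝ) + finrank ℝ Wᗮ + 2) * phi K) :
    ∫ e, excess W (tParam K a * finrank ℝ W / (finrank ℝ Wᗮ + 1)) 0 e ∂(stdGaussian E) ≤
      tParam K a * finrank ℝ W * Real.exp (-(finrank ℝ W * (a + phi K / 2))) := by
  have ht := one_lt_tParam hK ha
  have hd' : (0 : ℝ) < finrank ℝ W := by exact_mod_cast hd
  have hN' : (0 : ℝ) < finrank ℝ Wᗮ := by exact_mod_cast hN
  set d : ℝ := ((finrank ℝ W : ℕ) : ℝ) with hdd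
  set N : ℝ := ((finrank ℝ Wᗮ : ℕ) : ℝ) with hNN
  set t := tParam K a with htt
  set x : ℝ := ((t - 1) * N - 1) / (t * (d + N)) with hx
  have hx0 : 0 ≤ x := div_nonneg (by linarith) (by positivity)
  have e1 : 1 - x = (d + N + 1 + d * (t - 1)) / (t * (d + N)) := by
    rw [hx]; field_simp; ring
  have hs : 0 < t - 1 := by linarith
  have hx1 : x < 1 := by
    have : 0 < 1 - x := by rw [e1]; positivity
    linarith
  have h := integral_excess_le_finrank_mul W (c := t * d / (N + 1)) (b := 0) (by positivity) le_rfl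
    hx0 hx1
  rw [mul_zero, neg_zero, Real.exp_zero, one_mul] at h
  refine h.trans ?_
  have hc := exp_chernoff_le hK ha hd' hN' hdim hx
  -- The Chernoff prefactor costs nothing: with `n = d + N`, the claim is `n (n + 2 + z) ≤ (n + 2)
  -- (n + 1 + z)`.
  have hinv : (1 - x)⁻¹ * (1 + d * (t - 1) / (d + N + 2)) ≤ t := by
    set z := d * (t - 1) with hz
    have hz0 : 0 ≤ z := by positivity
    rw [e1, inv_div, div_mul_eq_mul_div, div_le_iff₀ (by positivity)]
    rw [mul_assoc]
    gcongr
    rw [show 1 + z / (d + N + 2) = (d + N + 2 + z) / (d + N + 2) by field_simp,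
      mul_div_assoc', div_le_iff₀ (by positivity)]
    nlinarith
  have hxi : 0 ≤ (1 - x)⁻¹ := inv_nonneg.2 (by linarith)
  calc d * ((1 - x)⁻¹ * _) ≤ d * ((1 - x)⁻¹ * ((1 + d * (t - 1) / (d + N + 2)) *
        Real.exp (-(d * (a + phi K / 2))))) := by gcongr
    _ = ((1 - x)⁻¹ * (1 + d * (t - 1) / (d + N + 2))) *
        (d * Real.exp (-(d * (a + phi K / 2)))) := by ring
    _ ≤ t * (d * Real.exp (-(d * (a + phi K / 2)))) := by gcongr
    _ = _ := by ring

theorem integral_excess_ratio_le_of_three_le (hK : 1 < K) (ha : 0 ≤ a) (hd : 0 < finrank ℝ W)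
    (ht3 : 3 ≤ tParam K a) (htN : 2 * tParam K a ≤ finrank ℝ Wᗮ + 1)
    (hdim : finrank ℝ W * (tParam K a - 1) ^ 2 ≤
      2 * ((finrank ℝ W : ℝ) + finrank ℝ Wᗮ + 2) * phi K) :
    ∫ e, excess W (tParam K a * finrank ℝ W / (finrank ℝ Wᗮ + 1)) 0 e ∂(stdGaussian E) ≤
      16 / Real.exp 1 * Real.exp (-(finrank ℝ W * (a + phi K / 2))) := by
  have hd' : (0 : ℝ) < finrank ℝ W := by exact_mod_cast hd
  set d : ℝ := ((finrank ℝ W : ℕ) : ℝ) with hdd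
  set N : ℝ := ((finrank ℝ Wᗮ : ℕ) : ℝ) with hNN
  have hdN := two_mul_dim_le hK ha (by positivity : 0 < d + N + 2) hdim
  have hdr := drift_le_one hK ha (by positivity : 0 < d + N + 2) hdim
  set t := tParam K a with htt
  have hN' : 0 < N := by linarith
  set x : ℝ := ((t - 1) * N - 1) / (t * (d + N)) with hx
  -- From `d ≤ N + 2` and `N ≥ 2t - 1`, the difference `4((t - 1)N - 1) - t(d + N)` is at least
  -- `4t(t - 3)`.
  have hx0 : 1 / 4 ≤ x := by
    rw [hx, div_le_div_iff₀ (by norm_num) (by positivity)]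
    nlinarith
  have e1 : 1 - x = (d + N + 1 + d * (t - 1)) / (t * (d + N)) := by
    rw [hx]; field_simp; ring
  have hs : 0 < t - 1 := by linarith
  have hx1 : x < 1 := by
    have : 0 < 1 - x := by rw [e1]; positivity
    linarith
  have h := integral_excess_le_two_div W (c := t * d / (N + 1)) (b := 0) (by positivity) le_rfl
    (by linarith) hx1
  rw [mul_zero, neg_zero, Real.exp_zero, one_mul] at h
  refine h.trans ?_
  have hc := exp_chernoff_le hK ha hd' hN' hdim hx
  have hxe : 2 / (x * Real.exp 1) ≤ 8 / Real.exp 1 := by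
    rw [div_le_div_iff₀ (by positivity) (by positivity)]
    nlinarith [Real.exp_pos 1]
  calc 2 / (x * Real.exp 1) * _ ≤ 8 / Real.exp 1 * (2 * Real.exp (-(d * (a + phi K / 2)))) := by
        gcongr
        refine hc.trans ?_
        gcongr
        linarith
    _ = _ := by ring

/-- The optimal exponential moment of `U ∼ χ²(d)` above the level `t d`. -/
theorem exp_chernoff_fixed_le {d N : ℝ} (hK : 1 < K) (ha : 0 ≤ a) (hd : 0 ≤ d) :
    Real.exp (-((1 - (tParam K a)⁻¹) / 2 * (tParam K a * d))) *
        Real.exp (-(d / 2) * Real.log (1 - (1 - (tParam K a)⁻¹))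
          - N / 2 * Real.log (1 + 0 * (1 - (tParam K a)⁻¹))) ≤
      Real.exp (-(d * (a + phi K / 2))) := by
  have ht := one_lt_tParam hK ha
  have hphi := add_le_phi_tParam hK ha
  have hK0 := phi_nonneg hK.le
  set t := tParam K a
  rw [← Real.exp_add, sub_sub_cancel, Real.log_inv, zero_mul, add_zero, Real.log_one]
  refine Real.exp_le_exp.2 ?_
  have e : -((1 - t⁻¹) / 2 * (t * d)) + (-(d / 2) * -Real.log t - N / 2 * 0) = -(d * phi t) := by
    simp only [phi]
    field_simp
    ring
  rw [e]
  nlinarith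

theorem integral_excess_fixed_le (hK : 1 < K) (ha : 0 ≤ a) :
    ∫ e, excess W 0 (tParam K a * finrank ℝ W) e ∂(stdGaussian E) ≤
      tParam K a * finrank ℝ W * Real.exp (-(finrank ℝ W * (a + phi K / 2))) := by
  have ht := one_lt_tParam hK ha
  have hc := exp_chernoff_fixed_le (N := finrank ℝ Wᗮ) hK ha (Nat.cast_nonneg (finrank ℝ W))
  set t := tParam K a
  have hti : t⁻¹ < 1 := inv_lt_one_of_one_lt₀ ht
  have hti0 : 0 < t⁻¹ := by positivity
  refine (integral_excess_le_finrank_mul W (x := 1 - t⁻¹) le_rfl (by positivity)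
    (by linarith) (by linarith)).trans ?_
  rw [show (1 - (1 - t⁻¹))⁻¹ = t by simp]
  have := mul_le_mul_of_nonneg_left hc (by positivity : 0 ≤ t * finrank ℝ W)
  linarith

theorem integral_excess_fixed_le_of_two_le (hK : 1 < K) (ha : 0 ≤ a) (ht2 : 2 ≤ tParam K a) :
    ∫ e, excess W 0 (tParam K a * finrank ℝ W) e ∂(stdGaussian E) ≤
      4 / Real.exp 1 * Real.exp (-(finrank ℝ W * (a + phi K / 2))) := by
  have hc := exp_chernoff_fixed_le (N := finrank ℝ Wᗮ) hK ha (Nat.cast_nonneg (finrank ℝ W))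
  set t := tParam K a
  have hti : t⁻¹ ≤ 2⁻¹ := inv_anti₀ (by norm_num) ht2
  have hti0 : 0 < t⁻¹ := by positivity
  refine (integral_excess_le_two_div W (x := 1 - t⁻¹) le_rfl (by positivity)
    (by linarith) (by linarith)).trans ?_
  have hxe : 2 / ((1 - t⁻¹) * Real.exp 1) ≤ 4 / Real.exp 1 := by
    have : 0 < (1 - t⁻¹) * Real.exp 1 := mul_pos (by linarith) (Real.exp_pos 1)
    rw [div_le_div_iff₀ this (by positivity)]
    nlinarith [Real.exp_pos 1]
  rw [mul_left_comm]
  gcongr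

/-- The total excess of `U ∼ χ²(d)` over its random and deterministic thresholds. -/
theorem integral_excess_add_le (hK : 1 < K) (ha : 0 ≤ a) (hd : 2 ≤ finrank ℝ W)
    (htN : 2 * tParam K a ≤ finrank ℝ Wᗮ + 1) (hsN : 2 ≤ (tParam K a - 1) * finrank ℝ Wᗮ)
    (hdim : finrank ℝ W * (tParam K a - 1) ^ 2 ≤
      2 * ((finrank ℝ W : ℝ) + finrank ℝ Wᗮ + 2) * phi K) :
    ∫ e, excess W (tParam K a * finrank ℝ W / (finrank ℝ Wᗮ + 1)) 0 e ∂(stdGaussian E) +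
        ∫ e, excess W 0 (tParam K a * finrank ℝ W) e ∂(stdGaussian E) ≤
      8 * ((finrank ℝ W : ℝ) - 1) * Real.exp (-(finrank ℝ W * (a + phi K / 2))) := by
  have ht := one_lt_tParam hK ha
  have hd' : (2 : ℝ) ≤ finrank ℝ W := by exact_mod_cast hd
  have hN : 0 < finrank ℝ Wᗮ := by
    have : (0 : ℝ) < finrank ℝ Wᗮ := by linarith
    exact_mod_cast this
  have hA := integral_excess_ratio_le W hK ha (by linarith) hN hsN hdim
  have hB := integral_excess_fixed_le W hK ha
  have he : 5 / 2 ≤ Real.exp 1 := by linarith [Real.exp_one_gt_d9]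
  have he1 : 4 / Real.exp 1 ≤ 8 / 5 := by
    rw [div_le_iff₀ (Real.exp_pos 1)]; linarith
  have hE := Real.exp_pos (-(finrank ℝ W * (a + phi K / 2)))
  -- The bounds linear in `t d` serve small `t`, the constant ones large `t`. With `d ≥ 2`, the
  -- three regimes give `4d`, `3d + 8/5` and `20/e ≤ 8`, each at most `8(d - 1)`.
  rcases le_total (tParam K a) 2 with h2 | h2
  · refine (add_le_add hA hB).trans ?_
    rw [← add_mul]
    gcongr
    nlinarith
  · have hD := integral_excess_fixed_le_of_two_le W hK ha h2
    rcases le_total (tParam K a) 3 with h3 | h3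
    · refine (add_le_add hA hD).trans ?_
      rw [← add_mul]
      gcongr
      nlinarith
    · have hC := integral_excess_ratio_le_of_three_le W hK ha (by linarith) h3 htN hdim
      refine (add_le_add hC hD).trans ?_
      rw [← add_mul]
      gcongr
      have : 16 / Real.exp 1 = 4 * (4 / Real.exp 1) := by ring
      linarith

end Excess

/-! ### Deterministic bounds on the loss -/

section Geometry

open Module

variable {E : Type*} [NormedAddCommGroup E] [InnerProductSpace ℝ E] [FiniteDimensional ℝ E]
  (S : Submodule ℝ E) {W : Submodule ℝ E}

theorem norm_sq_sub_starProjection (e : E) :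
    ‖e - S.starProjection e‖ ^ 2 = ‖e‖ ^ 2 - ‖S.starProjection e‖ ^ 2 := by
  rw [Submodule.norm_sq_eq_add_norm_sq_starProjection e S, S.starProjection_orthogonal_val]
  ring

theorem norm_sq_sub_estimator (μ e : E) (σ : ℝ) :
    ‖μ - S.starProjection (μ + σ • e)‖ ^ 2 =
      ‖μ - S.starProjection μ‖ ^ 2 + σ ^ 2 * ‖S.starProjection e‖ ^ 2 := by
  rw [map_add, map_smul, ← sub_sub, norm_sub_sq_real, inner_smul_right,
    Submodule.starProjection_inner_eq_zero _ _ (S.starProjection_apply_mem e), norm_smul, mul_pow,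
    Real.norm_eq_abs, sq_abs]
  ring

theorem norm_sq_residual (μ e : E) (σ : ℝ) :
    ‖μ + σ • e - S.starProjection (μ + σ • e)‖ ^ 2 =
      ‖μ - S.starProjection μ‖ ^ 2 + 2 * σ * inner ℝ (μ - S.starProjection μ) e
        + σ ^ 2 * ‖e - S.starProjection e‖ ^ 2 := by
  have h : μ + σ • e - S.starProjection (μ + σ • e) =
      (μ - S.starProjection μ) + σ • (e - S.starProjection e) := by
    rw [map_add, map_smul, smul_sub]; abel
  rw [h, norm_add_sq_real, inner_smul_right, inner_sub_right,
    Submodule.starProjection_inner_eq_zero _ _ (S.starProjection_apply_mem e), norm_smul, mul_pow,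
    Real.norm_eq_abs, sq_abs]
  ring

variable {S}

theorem starProjection_starProjection_of_le (hSW : S ≤ W) (e : E) :
    S.starProjection (W.starProjection e) = S.starProjection e :=
  congrArg (fun f : E →L[ℝ] E => f e) (Submodule.starProjection_comp_starProjection_of_le hSW)

/-- The vector `ν = μ - Π_S μ` lies in `W` and is orthogonal to `S`, so the noise meets it only
through `p = Π_W e - Π_S e`. The two sides differ by `K‖ν/K + σp‖² + (K + 1/K - 2) σ²‖Π_S e‖²`. -/
theorem estimator_loss_le {μ e : E} {σ K : ℝ} (hSW : S ≤ W) (hμ : μ ∈ W) (hK : 1 < K) :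
    (1 - 1 / K) * ‖μ - S.starProjection (μ + σ • e)‖ ^ 2 ≤
      ‖μ + σ • e - S.starProjection (μ + σ • e)‖ ^ 2 - σ ^ 2 * ‖e‖ ^ 2
        + K * (σ ^ 2 * ‖W.starProjection e‖ ^ 2) := by
  set ν := μ - S.starProjection μ with hν
  set p := W.starProjection e - S.starProjection e with hp
  have hνW : ν ∈ W := W.sub_mem hμ (hSW (S.starProjection_apply_mem μ))
  have hp2 : ‖p‖ ^ 2 = ‖W.starProjection e‖ ^ 2 - ‖S.starProjection e‖ ^ 2 := by
    have := norm_sq_sub_starProjection S (W.starProjection e)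
    rwa [starProjection_starProjection_of_le hSW] at this
  have hin : inner ℝ ν e = inner ℝ ν p := by
    rw [hp, inner_sub_right,
      Submodule.starProjection_inner_eq_zero _ _ (S.starProjection_apply_mem e), sub_zero,
      ← Submodule.inner_starProjection_left_eq_right, Submodule.starProjection_eq_self_iff.2 hνW]
  rw [norm_sq_sub_estimator, norm_sq_residual, norm_sq_sub_starProjection S e, ← hν, hin]
  have hK0 : 0 < K := by linarith
  have hsq : 0 ≤ K * ‖(1 / K) • ν + σ • p‖ ^ 2 := by positivity
  rw [norm_add_sq_real, inner_smul_right, real_inner_smul_left, norm_smul, norm_smul, mul_pow,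
    mul_pow, Real.norm_eq_abs, Real.norm_eq_abs, sq_abs, sq_abs] at hsq
  have e1 : K * ((1 / K) ^ 2 * ‖ν‖ ^ 2 + 2 * (σ * (1 / K * inner ℝ ν p)) + σ ^ 2 * ‖p‖ ^ 2) =
      1 / K * ‖ν‖ ^ 2 + 2 * σ * inner ℝ ν p + K * (σ ^ 2 * ‖p‖ ^ 2) := by field_simp
  rw [e1, hp2] at hsq
  have hKK : 2 ≤ K + 1 / K := by
    rw [show K + 1 / K = (K ^ 2 + 1) / K by field_simp, le_div_iff₀ hK0]
    nlinarith [sq_nonneg (K - 1)]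
  have hS : 0 ≤ (K + 1 / K - 2) * (σ ^ 2 * ‖S.starProjection e‖ ^ 2) :=
    mul_nonneg (by linarith) (by positivity)
  linarith

/-- The left side is the squared residual on `W`, as `μ ∈ W`; a smaller space leaves a larger
residual. -/
theorem le_norm_sq_residual {μ e : E} {σ : ℝ} (hSW : S ≤ W) (hμ : μ ∈ W) :
    σ ^ 2 * ‖e - W.starProjection e‖ ^ 2 ≤ ‖μ + σ • e - S.starProjection (μ + σ • e)‖ ^ 2 := by
  have h := norm_sq_residual W μ e σ
  rw [Submodule.starProjection_eq_self_iff.2 hμ, sub_self, norm_zero, inner_zero_left] at h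
  have h2 : ‖S.starProjection (μ + σ • e)‖ ≤ ‖W.starProjection (μ + σ • e)‖ := by
    rw [← starProjection_starProjection_of_le hSW]
    exact S.norm_starProjection_apply_le _
  have h3 : ‖S.starProjection (μ + σ • e)‖ ^ 2 ≤ ‖W.starProjection (μ + σ • e)‖ ^ 2 := by gcongr
  have h4 := norm_sq_sub_starProjection S (μ + σ • e)
  have h5 := norm_sq_sub_starProjection W (μ + σ • e)
  linarith

/-- The dimension is made exactly one larger even when `μ ∈ S`, so that the degrees of freedom of
`U` and `V` depend on the model only. -/
theorem exists_enlargement (μ : E) (hS : finrank ℝ S < finrank ℝ E) :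
    ∃ W : Submodule ℝ E, S ≤ W ∧ μ ∈ W ∧ finrank ℝ W = finrank ℝ S + 1 := by
  by_cases hμ : μ ∈ S
  · obtain ⟨v, -, hv⟩ := SetLike.exists_of_lt (Submodule.lt_top_of_finrank_lt_finrank hS)
    exact ⟨S ⊔ Submodule.span ℝ {v}, le_sup_left, Submodule.mem_sup_left hμ,
      Submodule.finrank_sup_span_singleton hv⟩
  · exact ⟨S ⊔ Submodule.span ℝ {μ}, le_sup_left,
      Submodule.mem_sup_right (Submodule.mem_span_singleton_self μ),
      Submodule.finrank_sup_span_singleton hμ⟩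

/-- The residual term of the penalized loss, in terms of the two excesses. -/
theorem sub_penalty_le_excess {K t D r p : ℝ} {e : E} (hK : 1 < K) (ht : 0 ≤ t) (hD : 0 ≤ D)
    (hr : 0 < r) (hp : K * t * D ≤ p) :
    K * ‖W.starProjection e‖ ^ 2 - ‖e - W.starProjection e‖ ^ 2 * (p / r) ≤
      K * (t + (excess W (t * (D + 1) / r) 0 e + excess W 0 (t * (D + 1)) e)) := by
  have h1 := excess_nonneg W (t * (D + 1) / r) 0 e
  have h2 := excess_nonneg W 0 (t * (D + 1)) e
  have h3 : ‖W.starProjection e‖ ^ 2 - t * (D + 1) / r * ‖e - W.starProjection e‖ ^ 2 - 0 ≤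
    excess W (t * (D + 1) / r) 0 e := le_max_left _ _
  have h4 : ‖W.starProjection e‖ ^ 2 - 0 * ‖e - W.starProjection e‖ ^ 2 - t * (D + 1) ≤
    excess W 0 (t * (D + 1)) e := le_max_left _ _
  set U := ‖W.starProjection e‖ ^ 2
  set V := ‖e - W.starProjection e‖ ^ 2
  have hV : 0 ≤ V := by positivity
  have h5 : V * (K * t * D / r) ≤ V * (p / r) := by gcongr
  have e1 : V * (K * t * D / r) = K * (t * D * (V / r)) := by ring
  have e2 : t * (D + 1) / r * V = t * D * (V / r) + t * (V / r) := by ring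
  rw [e1] at h5
  rw [e2] at h3
  have hX : 0 ≤ V / r := by positivity
  have htD : 0 ≤ t * D := by positivity
  refine (sub_le_sub_left h5 _).trans ?_
  rw [← mul_sub]
  gcongr
  -- If `V / r ≤ 1`, raising `D` to `D + 1` in the random threshold costs at most `t`. Otherwise the
  -- penalty already exceeds `t D`, and the deterministic threshold applies.
  rcases le_total (V / r) 1 with h | h
  · nlinarith
  · nlinarith

end Geometry

/-! ### Expected loss and residual of a fixed model -/

section Moments

open Module

variable {E : Type*} [NormedAddCommGroup E] [InnerProductSpace ℝ E] [FiniteDimensional ℝ E]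
  [MeasurableSpace E] [BorelSpace E] (S : Submodule ℝ E) (μ : E) (σ : ℝ)

theorem hasIntegral_norm_sq_residual_stdGaussian :
    Integrable (fun e => ‖e - S.starProjection e‖ ^ 2) (stdGaussian E) ∧
      ∫ e, ‖e - S.starProjection e‖ ^ 2 ∂(stdGaussian E) = finrank ℝ E - finrank ℝ S := by
  have h := hasIntegral_norm_sq_stdGaussian Sᗮ
  simp only [S.starProjection_orthogonal_val] at h
  rw [← S.finrank_add_finrank_orthogonal, Nat.cast_add, add_sub_cancel_left]
  exact h

theorem hasIntegral_norm_sq_id_stdGaussian :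
    Integrable (fun e : E => ‖e‖ ^ 2) (stdGaussian E) ∧
      ∫ e : E, ‖e‖ ^ 2 ∂(stdGaussian E) = finrank ℝ E := by
  simpa using hasIntegral_norm_sq_residual_stdGaussian (⊥ : Submodule ℝ E)

theorem hasIntegral_inner_stdGaussian (v : E) :
    Integrable (fun e => inner ℝ v e) (stdGaussian E) ∧
      ∫ e, inner ℝ v e ∂(stdGaussian E) = 0 :=
  ⟨(innerSL ℝ v).integrable_comp IsGaussian.integrable_id,
    integral_strongDual_stdGaussian (innerSL ℝ v)⟩

/-- The quadratic risk of the projection estimator. -/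
theorem hasIntegral_loss_stdGaussian :
    Integrable (fun e => ‖μ - S.starProjection (μ + σ • e)‖ ^ 2) (stdGaussian E) ∧
      ∫ e, ‖μ - S.starProjection (μ + σ • e)‖ ^ 2 ∂(stdGaussian E) =
        ‖μ - S.starProjection μ‖ ^ 2 + σ ^ 2 * finrank ℝ S := by
  have h := hasIntegral_norm_sq_stdGaussian S
  simp only [norm_sq_sub_estimator]
  refine ⟨(integrable_const _).add (h.1.const_mul _), ?_⟩
  rw [integral_add (integrable_const _) (h.1.const_mul _), integral_const_mul, h.2]
  simp

/-- The expected residual sum of squares. -/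
theorem hasIntegral_residual_stdGaussian :
    Integrable (fun e => ‖μ + σ • e - S.starProjection (μ + σ • e)‖ ^ 2) (stdGaussian E) ∧
      ∫ e, ‖μ + σ • e - S.starProjection (μ + σ • e)‖ ^ 2 ∂(stdGaussian E) =
        ‖μ - S.starProjection μ‖ ^ 2 + σ ^ 2 * (finrank ℝ E - finrank ℝ S) := by
  have h := hasIntegral_norm_sq_residual_stdGaussian S
  have h' := hasIntegral_inner_stdGaussian (μ - S.starProjection μ)
  simp only [norm_sq_residual]
  have i1 : Integrable (fun e => ‖μ - S.starProjection μ‖ ^ 2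
      + 2 * σ * inner ℝ (μ - S.starProjection μ) e) (stdGaussian E) :=
    (integrable_const _).add (h'.1.const_mul _)
  refine ⟨i1.add (h.1.const_mul _), ?_⟩
  rw [integral_add i1 (h.1.const_mul _), integral_add (integrable_const _) (h'.1.const_mul _),
    integral_const_mul, integral_const_mul, h.2, h'.2]
  simp

end Moments

/-! ### Consequences of the dimension restriction -/

section Dimension

variable {n D : ℕ} {K a : ℝ}

/-- The three inequalities unfold the two members of `γ₁` and then `γ₂`; `D ≥ 1` rules out the value
0 of the positive parts. In terms of `W`, `D + 1` and `n - D - 1` are the degrees of freedom. -/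
theorem dim_bounds (hK : 1 < K) (ha : 0 ≤ a) (hD : 1 ≤ D) (h : D ≤ dimMax n K a) :
    2 * tParam K a ≤ n - D ∧ 2 ≤ (tParam K a - 1) * (n - D - 1) ∧
      (D + 1) * (tParam K a - 1) ^ 2 ≤ 2 * (n + 2) * phi K := by
  have ht := one_lt_tParam hK ha
  have hs : 0 < tParam K a - 1 := by linarith
  have hD' : (0 : ℝ) < D := by exact_mod_cast hD
  have key : ∀ x : ℝ, D ≤ ⌊max x 0⌋₊ → (D : ℝ) ≤ x := fun x hx => by
    have := (Nat.le_floor_iff (le_max_right x 0)).1 hx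
    rcases le_max_iff.1 this with h | h
    · exact h
    · linarith
  have h1 := key _ (h.trans (min_le_left _ _))
  have h2 := key _ (h.trans (min_le_right _ _))
  have h3 : 2 * tParam K a ≤ gamma₁ K a := le_max_left _ _
  have h4 : (tParam K a + 1) / (tParam K a - 1) ≤ gamma₁ K a := le_max_right _ _
  refine ⟨by linarith, ?_, ?_⟩
  · rw [div_le_iff₀ hs] at h4
    nlinarith
  · have h5 : (D : ℝ) + 1 ≤ (n + 2) * gamma₂ K a := by linarith
    rw [gamma₂, mul_div_assoc', le_div_iff₀ (by positivity)] at h5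
    linarith

end Dimension

/-! ### Summation over the models -/

section Counting

variable {ι : Type*}

theorem sum_mul_pow_succ_le {q : ℝ} (hq : 0 ≤ q) (hq1 : q < 1) (s : Finset ℕ) :
    ∑ k ∈ s, (k : ℝ) * q ^ (k + 1) ≤ q ^ 2 / (1 - q) ^ 2 := by
  have h := (hasSum_coe_mul_geometric_of_norm_lt_one
    (by rwa [Real.norm_of_nonneg hq] : ‖q‖ < 1)).mul_left q
  have h2 := sum_le_hasSum s (fun k _ => by positivity) h
  calc ∑ k ∈ s, (k : ℝ) * q ^ (k + 1) = ∑ k ∈ s, q * (k * q ^ k) :=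
        Finset.sum_congr rfl fun k _ => by ring
    _ ≤ q * (q / (1 - q) ^ 2) := h2
    _ = _ := by ring

/-- Summation over a family of complexity index `(M, a)`. -/
theorem sum_models_le {D : ι → ℕ} {M a b : ℝ} (hM : 0 ≤ M) (hb : 0 < b)
    (hD : ∀ k : ℕ, 1 ≤ k → {m | D m = k}.Finite ∧
      ({m | D m = k}.ncard : ℝ) ≤ M * Real.exp (a * k))
    (F : Finset ι) (hF : ∀ m ∈ F, 1 ≤ D m) :
    ∑ m ∈ F, 8 * (D m : ℝ) * Real.exp (-((D m + 1) * (a + b))) ≤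
      8 * M * Real.exp (-a) / (Real.exp b - 1) ^ 2 := by
  classical
  rw [← Finset.sum_fiberwise_of_maps_to (fun m hm => Finset.mem_image_of_mem D hm)]
  set q := Real.exp (-b) with hq
  have hq1 : q < 1 := by simpa [hq] using hb
  have hk : ∀ k ∈ F.image D, ∑ m ∈ F with D m = k,
      8 * (D m : ℝ) * Real.exp (-((D m + 1) * (a + b))) ≤
        8 * M * Real.exp (-a) * (k * q ^ (k + 1)) := by
    intro k hk
    have hk1 : 1 ≤ k := by
      obtain ⟨m, hm, rfl⟩ := Finset.mem_image.1 hk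
      exact hF m hm
    have hcard : ((F.filter fun m => D m = k).card : ℝ) ≤ M * Real.exp (a * k) := by
      refine le_trans ?_ (hD k hk1).2
      rw [← Set.ncard_coe_finset]
      exact Nat.cast_le.2 (Set.ncard_le_ncard (by intro m; simp) (hD k hk1).1)
    rw [Finset.sum_congr rfl (g := fun _ => 8 * (k : ℝ) * Real.exp (-((k + 1) * (a + b))))
      (fun m hm => by rw [(Finset.mem_filter.1 hm).2]), Finset.sum_const, nsmul_eq_mul]
    -- The count contributes `exp (a k)` and the tail `exp (-(k + 1) a)`: only `exp (-a)` survives.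
    calc _ ≤ M * Real.exp (a * k) * (8 * (k : ℝ) * Real.exp (-((k + 1) * (a + b)))) := by gcongr
      _ = 8 * M * k * (Real.exp (a * k) * Real.exp (-((k + 1) * (a + b)))) := by ring
      _ = 8 * M * k * (Real.exp (-a) * q ^ (k + 1)) := by
        rw [hq, ← Real.exp_nat_mul, ← Real.exp_add, ← Real.exp_add]
        congr 2
        push_cast
        ring
      _ = _ := by ring
  refine (Finset.sum_le_sum hk).trans ?_
  rw [← Finset.mul_sum]
  have hs := sum_mul_pow_succ_le (Real.exp_pos _).le hq1 (F.image D)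
  have hqe : q ^ 2 / (1 - q) ^ 2 = 1 / (Real.exp b - 1) ^ 2 := by
    have hb1 : 0 < Real.exp b - 1 := by linarith [Real.add_one_lt_exp hb.ne']
    have : 1 - q = q * (Real.exp b - 1) := by
      rw [mul_sub, hq, ← Real.exp_add]; simp
    have hq0 : q ≠ 0 := (Real.exp_pos _).ne'
    rw [this]
    field_simp
  calc _ ≤ 8 * M * Real.exp (-a) * (1 / (Real.exp b - 1) ^ 2) := by
        gcongr
        exact hs.trans hqe.le
    _ = _ := by ring

end Counting

/-! ### The noise as a standard Gaussian vector -/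

section Noise

variable {n : ℕ} {Ω : Type*}

/-- The Gaussian noise vector. -/
noncomputable def noise (ε : Fin n → Ω → ℝ) (ω : Ω) : EuclideanSpace ℝ (Fin n) :=
  WithLp.toLp 2 fun i => ε i ω

theorem obs_eq (μ : EuclideanSpace ℝ (Fin n)) (σ : ℝ) (ε : Fin n → Ω → ℝ) (ω : Ω) :
    obs μ σ ε ω = μ + σ • noise ε ω := by
  ext i
  simp [obs, noise]

theorem hasLaw_noise [MeasurableSpace Ω] {P : Measure Ω} [IsProbabilityMeasure P]
    {ε : Fin n → Ω → ℝ} (hε : ∀ i, HasLaw (ε i) (gaussianReal 0 1) P) (hind : iIndepFun ε P) :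
    HasLaw (noise ε) (stdGaussian (EuclideanSpace ℝ (Fin n))) P := by
  have hm : AEMeasurable (fun ω i => ε i ω) P := aemeasurable_pi_lambda _ fun i => (hε i).aemeasurable
  have hL : Measurable (WithLp.toLp 2 : (Fin n → ℝ) → EuclideanSpace ℝ (Fin n)) := by fun_prop
  refine ⟨hL.comp_aemeasurable hm, ?_⟩
  have h := hind.map_fun_eq_pi_map fun i => (hε i).aemeasurable
  simp only [(hε _).map_eq] at h
  rw [← map_pi_eq_stdGaussian, ← h, AEMeasurable.map_map_of_aemeasurable hL.aemeasurable hm]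
  rfl

end Noise

/-! ### Risk of the selected estimator -/

section Selection

open Module

variable {n : ℕ} {ι Ω : Type*} {S : ι → Submodule ℝ (EuclideanSpace ℝ (Fin n))} {K M a σ : ℝ}
  {μ : EuclideanSpace ℝ (Fin n)} {pen : ι → ℝ}

theorem modelDim_le (S : ι → Submodule ℝ (EuclideanSpace ℝ (Fin n))) (m : ι) :
    modelDim S m ≤ n := by
  simpa [modelDim] using (S m).finrank_le

/-- Dimensions are at most `n`, so the excess of the random model can be bounded by a finite sum.
Null models, which the complexity index does not count, are treated apart. -/
theorem finite_modelDim_pos (hS : HasComplexityIndex S M a) : {m | 1 ≤ modelDim S m}.Finite := by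
  refine ((Finset.range (n + 1)).finite_toSet.biUnion fun D _ =>
    (?_ : {m | 1 ≤ modelDim S m ∧ modelDim S m = D}.Finite)).subset fun m hm => ?_
  · rcases Nat.eq_zero_or_pos D with rfl | hD
    · convert Set.finite_empty
      ext m
      simp only [Set.mem_ofPred_eq, Set.mem_empty_iff_false, iff_false]
      omega
    · exact (hS D hD).1.subset fun m hm => hm.2
  · simp only [Set.mem_iUnion]
    exact ⟨modelDim S m, by simpa using Nat.lt_succ_of_le (modelDim_le S m), hm, rfl⟩

/-- Spaces containing both the model and the mean, of dimension one more than the model. -/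
theorem exists_enlargements (hK : 1 < K) (ha : 0 ≤ a) (hdim : ∀ m, modelDim S m ≤ dimMax n K a)
    (μ : EuclideanSpace ℝ (Fin n)) :
    ∃ W : ι → Submodule ℝ (EuclideanSpace ℝ (Fin n)), ∀ m, 1 ≤ modelDim S m →
      S m ≤ W m ∧ μ ∈ W m ∧ finrank ℝ (W m) = modelDim S m + 1 := by
  classical
  have h : ∀ m, ∃ W : Submodule ℝ (EuclideanSpace ℝ (Fin n)), 1 ≤ modelDim S m →
      S m ≤ W ∧ μ ∈ W ∧ finrank ℝ W = modelDim S m + 1 := fun m => by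
    by_cases hm : 1 ≤ modelDim S m
    · have h1 := (dim_bounds hK ha hm (hdim m)).1
      have h2 := one_lt_tParam hK ha
      have h3 : (modelDim S m : ℝ) < n := by linarith
      obtain ⟨W, hW⟩ := exists_enlargement (S := S m) μ
        (by simpa [modelDim] using (Nat.cast_lt.1 h3))
      exact ⟨W, fun _ => hW⟩
    · exact ⟨⊥, fun h => absurd h hm⟩
  choose W hW using h
  exact ⟨W, hW⟩

/-- The sum of the two excesses of the model `m`. -/
noncomputable def modelExcess (S W : ι → Submodule ℝ (EuclideanSpace ℝ (Fin n))) (t : ℝ) (m : ι)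
    (e : EuclideanSpace ℝ (Fin n)) : ℝ :=
  excess (W m) (t * ((modelDim S m : ℝ) + 1) / ((n : ℝ) - modelDim S m)) 0 e
    + excess (W m) 0 (t * ((modelDim S m : ℝ) + 1)) e

theorem modelExcess_nonneg (S W : ι → Submodule ℝ (EuclideanSpace ℝ (Fin n))) (t : ℝ) (m : ι)
    (e : EuclideanSpace ℝ (Fin n)) : 0 ≤ modelExcess S W t m e :=
  add_nonneg (excess_nonneg _ _ _ _) (excess_nonneg _ _ _ _)

theorem integral_modelExcess_le (hK : 1 < K) (ha : 0 ≤ a) {W : ι → Submodule ℝ _} {m : ι}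
    (hdim : modelDim S m ≤ dimMax n K a) (hm : 1 ≤ modelDim S m)
    (hW : finrank ℝ (W m) = modelDim S m + 1) :
    Integrable (modelExcess S W (tParam K a) m) (stdGaussian _) ∧
      ∫ e, modelExcess S W (tParam K a) m e ∂(stdGaussian _) ≤
        8 * (modelDim S m : ℝ) * Real.exp (-((modelDim S m + 1) * (a + phi K / 2))) := by
  obtain ⟨h1, h2, h3⟩ := dim_bounds hK ha hm hdim
  have ht := one_lt_tParam hK ha
  have hN := (W m).finrank_add_finrank_orthogonal
  rw [finrank_euclideanSpace_fin, hW] at hN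
  have hN' : (finrank ℝ (W m)ᗮ : ℝ) = n - modelDim S m - 1 := by
    have := congrArg (Nat.cast : ℕ → ℝ) hN
    push_cast at this
    linarith
  have hd' : (finrank ℝ (W m) : ℝ) = modelDim S m + 1 := by rw [hW]; push_cast; ring
  have hr : (finrank ℝ (W m)ᗮ : ℝ) + 1 = n - modelDim S m := by rw [hN']; ring
  have key := integral_excess_add_le (W m) hK ha (by omega) (by rwa [hr]) (by rwa [hN'])
    (by rw [hd', hN']; convert h3 using 3; ring)
  rw [hr, hd', add_sub_cancel_right] at key
  have hc : 0 ≤ tParam K a * ((modelDim S m : ℝ) + 1) / ((n : ℝ) - modelDim S m) :=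
    div_nonneg (by positivity) (by linarith)
  have i1 := integrable_excess (W m) hc le_rfl
  have i2 := integrable_excess (W m) le_rfl
    (by positivity : 0 ≤ tParam K a * ((modelDim S m : ℝ) + 1))
  refine ⟨i1.add i2, ?_⟩
  unfold modelExcess
  rw [integral_add i1 i2]
  exact key

/-- The random upper bound of the loss of the selected estimator, as a function of the noise. -/
noncomputable def lossBound (S W : ι → Submodule ℝ (EuclideanSpace ℝ (Fin n))) (pen : ι → ℝ)
    (K t σ : ℝ) (μ : EuclideanSpace ℝ (Fin n)) (F : Finset ι) (m : ι)
    (e : EuclideanSpace ℝ (Fin n)) : ℝ :=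
  critL S pen (μ + σ • e) m - σ ^ 2 * ‖e‖ ^ 2
    + σ ^ 2 * (K * (t + (‖(Submodule.span ℝ {μ}).starProjection e‖ ^ 2
      + ∑ m' ∈ F, modelExcess S W t m' e)))

theorem loss_le_lossBound (hK : 1 < K) (ha : 0 ≤ a)
    (hdim : ∀ m, modelDim S m ≤ dimMax n K a)
    (hpen : ∀ m, K ^ 2 * phiInv a * modelDim S m ≤ pen m) {W : ι → Submodule ℝ _}
    (hW : ∀ m, 1 ≤ modelDim S m → S m ≤ W m ∧ μ ∈ W m ∧ finrank ℝ (W m) = modelDim S m + 1)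
    {F : Finset ι} (hF : ∀ m, m ∈ F ↔ 1 ≤ modelDim S m) {m m₀ : ι}
    {e : EuclideanSpace ℝ (Fin n)}
    (hm : critL S pen (μ + σ • e) m ≤ critL S pen (μ + σ • e) m₀) :
    (1 - 1 / K) * ‖μ - proj S m (μ + σ • e)‖ ^ 2 ≤
      lossBound S W pen K (tParam K a) σ μ F m₀ e := by
  have ht := one_lt_tParam hK ha
  have hf := one_le_phiInv ha
  set t := tParam K a with htt
  have hpen' : K * t * modelDim S m ≤ pen m := by
    refine le_trans (le_of_eq ?_) (hpen m)
    rw [htt, tParam]; ring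
  have hpen0 : 0 ≤ pen m := le_trans (by positivity) hpen'
  have hnD : (0 : ℝ) ≤ (n : ℝ) - modelDim S m := sub_nonneg.2 (Nat.cast_le.2 (modelDim_le S m))
  have hq : 0 ≤ pen m / ((n : ℝ) - modelDim S m) := by positivity
  have hsum : 0 ≤ ∑ m' ∈ F, modelExcess S W t m' e :=
    Finset.sum_nonneg fun m' _ => modelExcess_nonneg S W t m' e
  have general : ∀ V : Submodule ℝ (EuclideanSpace ℝ (Fin n)), S m ≤ V → μ ∈ V →
      (1 - 1 / K) * ‖μ - proj S m (μ + σ • e)‖ ^ 2 ≤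
        critL S pen (μ + σ • e) m₀ - σ ^ 2 * ‖e‖ ^ 2 + σ ^ 2 * (K * ‖V.starProjection e‖ ^ 2 -
          ‖e - V.starProjection e‖ ^ 2 * (pen m / ((n : ℝ) - modelDim S m))) := by
    intro V hSV hμV
    have h1 := estimator_loss_le (σ := σ) (e := e) hSV hμV hK
    have h2 := mul_le_mul_of_nonneg_right (le_norm_sq_residual (σ := σ) (e := e) hSV hμV) hq
    have h3 := hm
    unfold critL at h3 ⊢
    unfold proj at h3 ⊢
    linarith
  unfold lossBound
  -- All null models share the enlargement `span {μ}`, so their number is irrelevant and they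
  -- contribute a single term of mean at most 1.
  rcases Nat.eq_zero_or_pos (modelDim S m) with h0 | h0
  · have hbot : S m = ⊥ := Submodule.finrank_eq_zero.1 h0
    refine (general (Submodule.span ℝ {μ}) (hbot ▸ bot_le)
      (Submodule.mem_span_singleton_self μ)).trans ?_
    gcongr
    have : 0 ≤ ‖e - (Submodule.span ℝ {μ}).starProjection e‖ ^ 2 *
      (pen m / ((n : ℝ) - modelDim S m)) := by positivity
    nlinarith
  · obtain ⟨h1, h2, h3⟩ := hW m h0
    refine (general (W m) h1 h2).trans ?_
    gcongr
    have hr : (0 : ℝ) < (n : ℝ) - modelDim S m := by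
      linarith [(dim_bounds hK ha h0 (hdim m)).1]
    refine (sub_penalty_le_excess hK (by linarith) (Nat.cast_nonneg _) hr hpen').trans ?_
    refine mul_le_mul_of_nonneg_left ?_ (by linarith)
    have h4 := Finset.single_le_sum (f := fun m' => modelExcess S W t m' e)
      (fun m' _ => modelExcess_nonneg S W t m' e) ((hF m).2 h0)
    have h5 : 0 ≤ ‖(Submodule.span ℝ {μ}).starProjection e‖ ^ 2 := by positivity
    unfold modelExcess at h4 ⊢
    linarith

/-- The mean of the criterion is `(bias² + σ²(n - D)) (1 + pen / (n - D))`; subtracting `σ² n`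
leaves the penalized bias and `σ²(pen - D)`. -/
theorem integral_lossBound_le (hK : 1 < K) (hM : 0 ≤ M) (ha : 0 ≤ a) (hS : AssumptionH S K M a)
    (hpen : ∀ m, K ^ 2 * phiInv a * modelDim S m ≤ pen m) {W : ι → Submodule ℝ _}
    (hW : ∀ m, 1 ≤ modelDim S m → S m ≤ W m ∧ μ ∈ W m ∧ finrank ℝ (W m) = modelDim S m + 1)
    {F : Finset ι} (hF : ∀ m, m ∈ F ↔ 1 ≤ modelDim S m) (m : ι) :
    Integrable (lossBound S W pen K (tParam K a) σ μ F m) (stdGaussian _) ∧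
      ∫ e, lossBound S W pen K (tParam K a) σ μ F m e ∂(stdGaussian _) ≤
        ‖μ - proj S m μ‖ ^ 2 * (1 + pen m / ((n : ℝ) - modelDim S m))
          + σ ^ 2 * (pen m - modelDim S m)
          + σ ^ 2 * (K * (tParam K a + (1 +
            8 * M * Real.exp (-a) / (Real.exp (phi K / 2) - 1) ^ 2))) := by
  have ht := one_lt_tParam hK ha
  have hf := one_le_phiInv ha
  set t := tParam K a with htt
  have hpen0 : 0 ≤ pen m := le_trans (by positivity) (hpen m)
  have hnD : (0 : ℝ) ≤ (n : ℝ) - modelDim S m := sub_nonneg.2 (Nat.cast_le.2 (modelDim_le S m))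
  have hres := hasIntegral_residual_stdGaussian (S m) μ σ
  have hid := hasIntegral_norm_sq_id_stdGaussian (E := EuclideanSpace ℝ (Fin n))
  have hspan := hasIntegral_norm_sq_stdGaussian (Submodule.span ℝ {μ})
  have hex := fun m' (hm' : m' ∈ F) =>
    integral_modelExcess_le hK ha (hS.2 m') ((hF m').1 hm') (hW m' ((hF m').1 hm')).2.2
  rw [finrank_euclideanSpace_fin] at hres hid
  have i1 : Integrable (fun e => critL S pen (μ + σ • e) m) (stdGaussian _) :=
    hres.1.mul_const _
  have i2 := hid.1.const_mul (σ ^ 2)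
  have i3 : Integrable (fun e => ∑ m' ∈ F, modelExcess S W t m' e) (stdGaussian _) :=
    integrable_finsetSum _ fun m' hm' => (hex m' hm').1
  have i4 : Integrable (fun e => ‖(Submodule.span ℝ {μ}).starProjection e‖ ^ 2
      + ∑ m' ∈ F, modelExcess S W t m' e) (stdGaussian _) := hspan.1.add i3
  have i5 : Integrable (fun e => σ ^ 2 * (K * (t +
      (‖(Submodule.span ℝ {μ}).starProjection e‖ ^ 2
        + ∑ m' ∈ F, modelExcess S W t m' e)))) (stdGaussian _) :=
    (((integrable_const t).add i4).const_mul K).const_mul (σ ^ 2)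
  have i6 : Integrable (fun e => critL S pen (μ + σ • e) m - σ ^ 2 * ‖e‖ ^ 2) (stdGaussian _) :=
    i1.sub i2
  refine ⟨i6.add i5, ?_⟩
  have hcrit : ∫ e, critL S pen (μ + σ • e) m ∂(stdGaussian _) =
      (‖μ - proj S m μ‖ ^ 2 + σ ^ 2 * ((n : ℝ) - modelDim S m)) *
        (1 + pen m / ((n : ℝ) - modelDim S m)) := by
    unfold critL
    rw [integral_mul_const]
    exact congrArg (· * _) hres.2
  have hsum : ∫ e, ∑ m' ∈ F, modelExcess S W t m' e ∂(stdGaussian _) ≤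
      8 * M * Real.exp (-a) / (Real.exp (phi K / 2) - 1) ^ 2 := by
    rw [integral_finsetSum _ fun m' hm' => (hex m' hm').1]
    exact (Finset.sum_le_sum fun m' hm' => (hex m' hm').2).trans
      (sum_models_le hM (half_pos (phi_pos hK)) hS.1 F fun m' hm' => (hF m').1 hm')
  have hspan1 : (finrank ℝ (Submodule.span ℝ {μ}) : ℝ) ≤ 1 := by
    exact_mod_cast (finrank_span_le_card ({μ} : Set _)).trans (by simp)
  -- Only an inequality holds in general: if `n = D`, division by zero makes the left side 0.
  have hpenr : ((n : ℝ) - modelDim S m) * (pen m / ((n : ℝ) - modelDim S m)) ≤ pen m := by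
    rcases hnD.eq_or_lt with h | h
    · rw [← h, zero_mul]; exact hpen0
    · rw [mul_div_cancel₀ _ h.ne']
  have heq : ∫ e, lossBound S W pen K t σ μ F m e ∂(stdGaussian _) =
      (‖μ - proj S m μ‖ ^ 2 + σ ^ 2 * ((n : ℝ) - modelDim S m)) *
        (1 + pen m / ((n : ℝ) - modelDim S m)) - σ ^ 2 * n
        + σ ^ 2 * (K * (t + ((finrank ℝ (Submodule.span ℝ {μ}) : ℝ)
          + ∫ e, ∑ m' ∈ F, modelExcess S W t m' e ∂(stdGaussian _)))) := by
    unfold lossBound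
    rw [integral_add i6 i5, integral_sub i1 i2, hcrit, integral_const_mul, hid.2,
      integral_const_mul, integral_const_mul,
      integral_add (integrable_const _) i4, integral_add hspan.1 i3, hspan.2]
    simp
  rw [heq]
  have h1 : σ ^ 2 * (K * (t + ((finrank ℝ (Submodule.span ℝ {μ}) : ℝ)
      + ∫ e, ∑ m' ∈ F, modelExcess S W t m' e ∂(stdGaussian _)))) ≤
      σ ^ 2 * (K * (t + (1 + 8 * M * Real.exp (-a) / (Real.exp (phi K / 2) - 1) ^ 2))) := by
    gcongr
  have h2 : σ ^ 2 * (((n : ℝ) - modelDim S m) * (pen m / ((n : ℝ) - modelDim S m))) ≤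
    σ ^ 2 * pen m := by gcongr
  linarith

theorem integral_loss_eq [MeasurableSpace Ω] {P : Measure Ω} {ε : Fin n → Ω → ℝ}
    (hlaw : HasLaw (noise ε) (stdGaussian _) P) (m : ι) :
    ∫ ω, ‖μ - proj S m (obs μ σ ε ω)‖ ^ 2 ∂P =
      ‖μ - proj S m μ‖ ^ 2 + σ ^ 2 * modelDim S m := by
  have h := hasIntegral_loss_stdGaussian (S m) μ σ
  have h2 := hlaw.integral_comp h.1.aestronglyMeasurable
  rw [h.2] at h2
  simp only [obs_eq]
  exact h2

/-- The restriction gives `2(D + 1) ≤ n + 2`, so `D ≤ n - D`. With `L = K²φ⁻¹(a) ≥ 1`, the factor on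
the bias is then at most `1 + L ≤ 2L`. -/
theorem penalized_bias_le (hK : 1 < K) (ha : 0 ≤ a) (hσ : 0 < σ) {m : ι}
    (hdim : modelDim S m ≤ dimMax n K a) {b : ℝ} (hb : 0 ≤ b) :
    b / σ ^ 2 * (1 + K ^ 2 * phiInv a * modelDim S m / ((n : ℝ) - modelDim S m))
        + K ^ 2 * phiInv a * modelDim S m - modelDim S m ≤
      2 * K ^ 2 * phiInv a / σ ^ 2 * (b + σ ^ 2 * modelDim S m) := by
  have hf := one_le_phiInv ha
  have hL : 1 ≤ K ^ 2 * phiInv a := by nlinarith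
  set L := K ^ 2 * phiInv a
  have hr : L * modelDim S m / ((n : ℝ) - modelDim S m) ≤ L := by
    rcases Nat.eq_zero_or_pos (modelDim S m) with h0 | h0
    · rw [h0]; simp; linarith
    · obtain ⟨h1, -, h3⟩ := dim_bounds hK ha h0 hdim
      have h4 := two_mul_dim_le hK ha (by positivity : (0 : ℝ) < n + 2) h3
      have h5 := one_lt_tParam hK ha
      rw [div_le_iff₀ (by linarith)]
      gcongr
      linarith
  have hD : (0 : ℝ) ≤ modelDim S m := Nat.cast_nonneg _
  have e : 2 * K ^ 2 * phiInv a / σ ^ 2 * (b + σ ^ 2 * modelDim S m) =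
      b / σ ^ 2 * (2 * L) + 2 * L * modelDim S m := by
    simp only [L]; field_simp
  rw [e]
  have h6 : b / σ ^ 2 * (1 + L * modelDim S m / ((n : ℝ) - modelDim S m)) ≤
      b / σ ^ 2 * (2 * L) := by
    gcongr
    linarith
  have h7 : 0 ≤ L * modelDim S m := by positivity
  linarith

variable [MeasurableSpace Ω] {P : Measure Ω} {ε : Fin n → Ω → ℝ}
  [Countable ι] {mHat : Ω → ι}

theorem aestronglyMeasurable_loss (hlaw : HasLaw (noise ε) (stdGaussian _) P)
    (hm : ∀ m, MeasurableSet {ω | mHat ω = m}) :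
    AEStronglyMeasurable (fun ω => ‖μ - proj S (mHat ω) (obs μ σ ε ω)‖ ^ 2) P := by
  let _ : MeasurableSpace ι := ⊤
  have h1 : Measurable mHat := measurable_to_countable' hm
  have h2 : Measurable fun p : ι × EuclideanSpace ℝ (Fin n) =>
      ‖μ - proj S p.1 (μ + σ • p.2)‖ ^ 2 := by
    refine measurable_from_prod_countable_right fun m => ?_
    have h3 : Measurable fun y : EuclideanSpace ℝ (Fin n) => μ + σ • y := by fun_prop
    exact (((S m).starProjection.measurable.comp h3).const_sub μ).norm.pow_const 2
  simp only [obs_eq]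
  exact (h2.comp_aemeasurable (h1.aemeasurable.prodMk hlaw.aemeasurable)).aestronglyMeasurable

/-- The risk bound of the selected estimator against a fixed model. -/
theorem risk_le [IsProbabilityMeasure P] (hK : 1 < K) (hM : 0 ≤ M) (ha : 0 ≤ a)
    (hlaw : HasLaw (noise ε) (stdGaussian _) P) (hS : AssumptionH S K M a)
    (hpen : ∀ m, K ^ 2 * phiInv a * modelDim S m ≤ pen m)
    (hm : ∀ m, MeasurableSet {ω | mHat ω = m})
    (hmin : ∀ᵐ ω ∂P, ∀ m, critL S pen (obs μ σ ε ω) (mHat ω) ≤ critL S pen (obs μ σ ε ω) m)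
    (m : ι) :
    Integrable (fun ω => ‖μ - proj S (mHat ω) (obs μ σ ε ω)‖ ^ 2) P ∧
      (1 - 1 / K) * ∫ ω, ‖μ - proj S (mHat ω) (obs μ σ ε ω)‖ ^ 2 ∂P ≤
        ‖μ - proj S m μ‖ ^ 2 * (1 + pen m / ((n : ℝ) - modelDim S m))
          + σ ^ 2 * (pen m - modelDim S m)
          + σ ^ 2 * (K * (tParam K a + (1 +
            8 * M * Real.exp (-a) / (Real.exp (phi K / 2) - 1) ^ 2))) := by
  obtain ⟨W, hW⟩ := exists_enlargements hK ha hS.2 μ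
  have hF : ∀ m, m ∈ (finite_modelDim_pos hS.1).toFinset ↔ 1 ≤ modelDim S m := by simp
  set F := (finite_modelDim_pos hS.1).toFinset
  have hb := integral_lossBound_le (σ := σ) hK hM ha hS hpen hW hF m
  have hae : ∀ᵐ ω ∂P, (1 - 1 / K) * ‖μ - proj S (mHat ω) (obs μ σ ε ω)‖ ^ 2 ≤
      lossBound S W pen K (tParam K a) σ μ F m (noise ε ω) := by
    filter_upwards [hmin] with ω hω
    have h := hω m
    rw [obs_eq] at h ⊢
    exact loss_le_lossBound hK ha hS.2 hpen hW hF h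
  have hK1 : 0 < 1 - 1 / K := by
    rw [sub_pos, div_lt_one (by linarith)]; exact hK
  have hbi : Integrable (fun ω => lossBound S W pen K (tParam K a) σ μ F m (noise ε ω)) P := by
    have := hb.1
    rw [← hlaw.map_eq] at this
    exact this.comp_aemeasurable hlaw.aemeasurable
  have hms := aestronglyMeasurable_loss (S := S) (μ := μ) (σ := σ) hlaw hm
  have hint : Integrable (fun ω => (1 - 1 / K) * ‖μ - proj S (mHat ω) (obs μ σ ε ω)‖ ^ 2) P := by
    refine hbi.mono' (hms.const_mul _) ?_
    filter_upwards [hae] with ω hω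
    rwa [Real.norm_of_nonneg (by positivity)]
  refine ⟨(integrable_const_mul_iff hK1.ne'.isUnit _).1 hint, ?_⟩
  rw [← integral_const_mul]
  refine (integral_mono_ae hint hbi hae).trans ?_
  have := hlaw.integral_comp hb.1.aestronglyMeasurable
  simp only [Function.comp_def] at this
  rw [this]
  exact hb.2

end Selection

end GaussianModelSelection

/-! ### The oracle inequality -/

theorem theorem1 (K M : ℝ) (hK : 1 < K) (hM : 0 ≤ M) :
    ∃ C : ℝ, 0 < C ∧
      ∀ (a : ℝ), 0 ≤ a →
      ∀ (n : ℕ) (μ : EuclideanSpace ℝ (Fin n)) (σ : ℝ), 0 < σ →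
      ∀ {Ω : Type*} [MeasurableSpace Ω] (P : Measure Ω) [IsProbabilityMeasure P]
        (ε : Fin n → Ω → ℝ),
        (∀ i, HasLaw (ε i) (gaussianReal 0 1) P) → iIndepFun ε P →
      ∀ {ι : Type*} [Countable ι] (S : ι → Submodule ℝ (EuclideanSpace ℝ (Fin n))),
        AssumptionH S K M a →
      ∀ (pen : ι → ℝ), (∀ m, K ^ 2 * phiInv a * modelDim S m ≤ pen m) →
      ∀ (mHat : Ω → ι), (∀ m, MeasurableSet {ω | mHat ω = m}) →
        (∀ᵐ ω ∂P, ∀ m, critL S pen (obs μ σ ε ω) (mHat ω) ≤ critL S pen (obs μ σ ε ω) m) →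
      Integrable (fun ω => ‖μ - proj S (mHat ω) (obs μ σ ε ω)‖ ^ 2) P ∧
      (∫ ω, ‖μ - proj S (mHat ω) (obs μ σ ε ω)‖ ^ 2 / σ ^ 2 ∂P
        ≤ K / (K - 1) *
            (⨅ m, (‖μ - proj S m μ‖ ^ 2 / σ ^ 2 * (1 + pen m / ((n : ℝ) - modelDim S m))
              + pen m - modelDim S m))
          + remainder K M a) ∧
      ((∀ m, pen m = K ^ 2 * phiInv a * modelDim S m) →
        ∫ ω, ‖μ - proj S (mHat ω) (obs μ σ ε ω)‖ ^ 2 ∂P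
          ≤ C * phiInv a * max (oracleRisk P (obs μ σ ε) μ S) (σ ^ 2)) := by
  have hK0 : 0 < K - 1 := by linarith
  set B := (Real.exp (phi K / 2) - 1) ^ 2 with hB
  have hB0 : 0 ≤ B := sq_nonneg _
  -- The first summand compares the infimum with the oracle risk; the second bounds the remainder,
  -- using `exp (-a) ≤ 1 ≤ φ⁻¹(a)`.
  refine ⟨K / (K - 1) * (2 * K ^ 2) + K / (K - 1) * (K ^ 2 + 2 * K + 8 * K * M / B), by positivity,
    ?_⟩
  intro a ha n μ σ hσ Ω _ P _ ε hε hind ι _ S hS pen hpen mHat hm hmin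
  have hlaw := hasLaw_noise hε hind
  have hf := one_le_phiInv ha
  have hrisk := risk_le hK hM ha hlaw hS hpen hm hmin
  have hne : Nonempty ι := by
    obtain ⟨ω⟩ : Nonempty Ω := nonempty_of_isProbabilityMeasure P
    exact ⟨mHat ω⟩
  set I := ∫ ω, ‖μ - proj S (mHat ω) (obs μ σ ε ω)‖ ^ 2 ∂P with hI
  have hσ2 : 0 < σ ^ 2 := by positivity
  have hbound : I / σ ^ 2 ≤ K / (K - 1) *
      (⨅ m, (‖μ - proj S m μ‖ ^ 2 / σ ^ 2 * (1 + pen m / ((n : ℝ) - modelDim S m))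
        + pen m - modelDim S m)) + remainder K M a := by
    have key : (K - 1) / K * (I / σ ^ 2 - remainder K M a) ≤
        ⨅ m, (‖μ - proj S m μ‖ ^ 2 / σ ^ 2 * (1 + pen m / ((n : ℝ) - modelDim S m))
          + pen m - modelDim S m) := by
      refine le_ciInf fun m => ?_
      have h := div_le_div_of_nonneg_right (hrisk m).2 hσ2.le
      have e1 : (1 - 1 / K) * I / σ ^ 2 = (K - 1) / K * (I / σ ^ 2) := by field_simp
      -- The bound to be matched has only `K` in place of this `2 * K`, so there is slack.
      have e2 : (K - 1) / K * remainder K M a =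
          K * tParam K a + 2 * K + K * (8 * M * Real.exp (-a) / B) := by
        rw [remainder, tParam, ← hB]; field_simp
      have e3 : ∀ b q p r : ℝ, (b * q + σ ^ 2 * p + σ ^ 2 * r) / σ ^ 2 =
          b / σ ^ 2 * q + p + r := fun b q p r => by field_simp
      rw [e1, e3] at h
      rw [mul_sub, e2]
      linarith
    have h2 := mul_le_mul_of_nonneg_left key (by positivity : 0 ≤ K / (K - 1))
    have e : K / (K - 1) * ((K - 1) / K * (I / σ ^ 2 - remainder K M a)) =
        I / σ ^ 2 - remainder K M a := by field_simp
    rw [e] at h2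
    linarith
  refine ⟨(hrisk hne.some).1, by rwa [integral_div], fun hpeneq => ?_⟩
  have hinf : (⨅ m, (‖μ - proj S m μ‖ ^ 2 / σ ^ 2 * (1 + pen m / ((n : ℝ) - modelDim S m))
      + pen m - modelDim S m)) ≤
      2 * K ^ 2 * phiInv a / σ ^ 2 * oracleRisk P (obs μ σ ε) μ S := by
    have hpos : 0 < 2 * K ^ 2 * phiInv a / σ ^ 2 := by positivity
    rw [← div_le_iff₀' hpos]
    refine le_ciInf fun m => ?_
    rw [div_le_iff₀' hpos, integral_loss_eq hlaw]
    refine (ciInf_le ⟨0, ?_⟩ m).trans ?_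
    · rintro _ ⟨m', rfl⟩
      have hnD : (0 : ℝ) ≤ (n : ℝ) - modelDim S m' :=
        sub_nonneg.2 (Nat.cast_le.2 (modelDim_le S m'))
      have h1 : (modelDim S m' : ℝ) ≤ pen m' := by
        refine le_trans ?_ (hpen m')
        have hL : 1 ≤ K ^ 2 * phiInv a := by nlinarith
        exact le_mul_of_one_le_left (Nat.cast_nonneg _) hL
      have h2 : 0 ≤ pen m' := le_trans (Nat.cast_nonneg _) h1
      have h3 : 0 ≤ ‖μ - proj S m' μ‖ ^ 2 / σ ^ 2 * (1 + pen m' / ((n : ℝ) - modelDim S m')) := by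
        positivity
      simp only
      linarith
    · simp only [hpeneq m]
      exact penalized_bias_le hK ha hσ (hS.2 m) (sq_nonneg _)
  have hrem : remainder K M a ≤ K / (K - 1) * (K ^ 2 + 2 * K + 8 * K * M / B) * phiInv a := by
    rw [remainder, ← hB]
    have hexp : Real.exp (-a) ≤ 1 := Real.exp_le_one_iff.2 (by linarith)
    have h1 : 8 * K * M * Real.exp (-a) / B ≤ 8 * K * M / B * phiInv a := by
      rw [div_mul_eq_mul_div]
      gcongr
      linarith
    refine (mul_le_mul_of_nonneg_left ?_ (by positivity)).trans_eq (mul_assoc _ _ _).symm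
    nlinarith
  set R := max (oracleRisk P (obs μ σ ε) μ S) (σ ^ 2)
  have hR1 : oracleRisk P (obs μ σ ε) μ S ≤ R := le_max_left _ _
  have hR2 : σ ^ 2 ≤ R := le_max_right _ _
  rw [div_le_iff₀ hσ2] at hbound
  calc I ≤ (K / (K - 1) * (2 * K ^ 2 * phiInv a / σ ^ 2 * R)
        + K / (K - 1) * (K ^ 2 + 2 * K + 8 * K * M / B) * phiInv a) * σ ^ 2 := by
        refine hbound.trans ?_
        gcongr
        exact hinf.trans (by gcongr)
    _ = K / (K - 1) * (2 * K ^ 2) * phiInv a * R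
        + K / (K - 1) * (K ^ 2 + 2 * K + 8 * K * M / B) * phiInv a * σ ^ 2 := by
        field_simp
    _ ≤ K / (K - 1) * (2 * K ^ 2) * phiInv a * R
        + K / (K - 1) * (K ^ 2 + 2 * K + 8 * K * M / B) * phiInv a * R := by
        gcongr
    _ = _ := by ring
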